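/- Let $m,n\ge 1$ be integers and let $0<\alpha<n$, $q>0$, $1<p_1,\dots,p_m<\infty$ with $$\frac1{p_1}+\cdots+\frac1{p_m}=\frac1q+\frac{\alpha}{n}.$$ Write $p_i'=p_i/(p_i-1)$. Suppose that $p'_{i_0}=\max_{1\le i\le m}p_i'$ for some $i_0$ and that $$p'_{i_0}\Bigl(1-\frac{\alpha}{n}\Bigr)\ge p_i'\qquad\text{for all } i\ne i_0 .$$ A weight is a non-negative locally integrable function on $\mathbb R^n$, and cubes have sides parallel to the axes. For an $m$-tuple of weights $\vec w=(w_1,\dots,w_m)$ put $u_{\vec w}=(\prod_{i=1}^m w_i)^q$, $\sigma_i=w_i^{-p_i'}$ and $$[\vec w]_{A_{\vec P,q}}=\sup_{Q}\Bigl(\frac1{|Q|}\int_Q u_{\vec w}\Bigr)\prod_{i=1}^m\Bigl(\frac1{|Q|}\int_Q\sigma_i\Bigr)^{q/p_i'},$$ the supremum being over all cubes $Q\subset\mathbb R^n$ (with $0^{-p_i'}=\infty$ and $0\cdot\infty=0$); $\vec w\in A_{\vec P,q}$ means that this is finite. Let $$\mathcal M_\alpha(\vec f)(x)=\sup_{Q\ni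 x}\prod_{i=1}^m\frac1{|Q|^{1-\alpha/(mn)}}\int_Q|f_i(y_i)|\,dy_i .$$ Then $\mathcal M_\alpha$ maps $L^{p_1}(w_1^{p_1})\times\cdots\times L^{p_m}(w_m^{p_m})$ into $L^q(u_{\vec w})$ for every $\vec w\in A_{\vec P,q}$, and there is a finite constant $C$, depending only on $m,n,p_1,\dots,p_m,q$, such that for all $\vec w\in A_{\vec P,q}$ and all $f_i\in L^{p_i}(w_i^{p_i})$ $$\|\mathcal M_\alpha(\vec f)\|_{L^q(u_{\vec w})}\le C\,[\vec w]_{A_{\vec P,q}}^{(1-\frac{\alpha}{n})\frac{\max_i p_i'}{q}}\prod_{i=1}^m\|f_i\|_{L^{p_i}(w_i^{p_i})}.$$ The exponent of $[\vec w]_{A_{\vec P,q}}$ is sharp: for the same $m,n,\alpha,q,p_1,\dots,p_m$ and any real $\beta<(1-\frac\alpha n)\frac{\max_i p_i'}{q}$, there is no finite constant $C$ for which this inequality, with the exponent replaced by $\beta$, holds for all $\vec w\in A_{\vec P,q}$ and all $f_i\in L^{p_i}(w_i^{p_i})$. -/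

import Mathlib

open MeasureTheory
open scoped ENNReal NNReal

noncomputable section

namespace MultiFrac

/-- The (open) cube in `ℝⁿ` with sides parallel to the axes, lower corner `a` and side length `l`. -/
def cube {n : ℕ} (a : Fin n → ℝ) (l : ℝ) : Set (Fin n → ℝ) :=
  Set.univ.pi fun j => Set.Ioo (a j) (a j + l)

/-- The average `(1/|Q|) ∫_Q g` of a nonnegative function, `Q` being the cube `cube a l`. -/
def cubeAvg {n : ℕ} (g : (Fin n → ℝ) → ℝ≥0∞) (a : Fin n → ℝ) (l : ℝ) : ℝ≥0∞ :=
  (∫⁻ y in cube a l, g y) / volume (cube a l)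

/-- A weight: a non-negative locally integrable function on `ℝⁿ`. -/
structure IsWeight {n : ℕ} (w : (Fin n → ℝ) → ℝ) : Prop where
  nonneg : ∀ x, 0 ≤ w x
  locallyIntegrable : LocallyIntegrable w volume

/-- The real power `w ^ s` of a weight, with values in `[0, ∞]`; for negative `s` it is `∞` where
`w` vanishes. -/
def wpow {n : ℕ} (w : (Fin n → ℝ) → ℝ) (s : ℝ) (x : Fin n → ℝ) : ℝ≥0∞ :=
  ENNReal.ofReal (w x) ^ s

/-- `u_w = (w₁ ⋯ w_m) ^ q`. -/
def uWeight {m n : ℕ} (q : ℝ) (w : Fin m → (Fin n → ℝ) → ℝ) : (Fin n → ℝ) → ℝ≥0∞ :=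
  wpow (fun x => ∏ i, w i x) q

/-- `σ_i = w_i ^ (-p_i')`. -/
def sigmaWeight {m n : ℕ} (p : Fin m → ℝ) (w : Fin m → (Fin n → ℝ) → ℝ) (i : Fin m) :
    (Fin n → ℝ) → ℝ≥0∞ :=
  wpow (w i) (-(p i).conjExponent)

/-- The constant `[w]_{A_{P,q}}`, the supremum over all cubes `Q` of
`(⨍_Q u_w) ∏ᵢ (⨍_Q σ_i) ^ (q / p_i')`. -/
def apqConst {m n : ℕ} (p : Fin m → ℝ) (q : ℝ) (w : Fin m → (Fin n → ℝ) → ℝ) : ℝ≥0∞ :=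
  ⨆ (a : Fin n → ℝ) (l : ℝ) (_ : 0 < l),
    cubeAvg (uWeight q w) a l *
      ∏ i, cubeAvg (sigmaWeight p w i) a l ^ (q / (p i).conjExponent)

/-- The class `A_{P,q}` of multiple weights. -/
structure MemApq {m n : ℕ} (p : Fin m → ℝ) (q : ℝ) (w : Fin m → (Fin n → ℝ) → ℝ) : Prop where
  isWeight : ∀ i, IsWeight (w i)
  const_lt_top : apqConst p q w < ∞

/-- The multilinear fractional maximal function
`M_α(f)(x) = sup_{Q ∋ x} ∏ᵢ |Q| ^ (-(1 - α/(mn))) ∫_Q |f_i|`. -/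
def maximalFn {m n : ℕ} (α : ℝ) (f : Fin m → (Fin n → ℝ) → ℂ) (x : Fin n → ℝ) : ℝ≥0∞ :=
  ⨆ (a : Fin n → ℝ) (l : ℝ) (_ : 0 < l) (_ : x ∈ cube a l),
    ∏ i, (∫⁻ y in cube a l, ‖f i y‖ₑ) / volume (cube a l) ^ (1 - α / (m * n : ℝ))

/-- The measure `w_i ^ {p_i} dx`. -/
def sourceMeasure {m n : ℕ} (p : Fin m → ℝ) (w : Fin m → (Fin n → ℝ) → ℝ) (i : Fin m) :
    Measure (Fin n → ℝ) :=
  volume.withDensity (wpow (w i) (p i))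

/-- The measure `u_w dx`. -/
def targetMeasure {m n : ℕ} (q : ℝ) (w : Fin m → (Fin n → ℝ) → ℝ) : Measure (Fin n → ℝ) :=
  volume.withDensity (uWeight q w)

/-- `f_i ∈ L^{p_i}(w_i^{p_i})` for every `i`. -/
def MemSource {m n : ℕ} (p : Fin m → ℝ) (w : Fin m → (Fin n → ℝ) → ℝ)
    (f : Fin m → (Fin n → ℝ) → ℂ) : Prop :=
  ∀ i, MemLp (f i) (ENNReal.ofReal (p i)) (sourceMeasure p w i)

/-- The inequality
`‖M_α f‖_{L^q(u_w)} ≤ C [w]_{A_{P,q}}^β ∏ᵢ ‖f_i‖_{L^{p_i}(w_i^{p_i})}`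
holds, with the constant `C` and the exponent `β`, for all `w ∈ A_{P,q}` and all
`f_i ∈ L^{p_i}(w_i^{p_i})`. -/
def WeightedBound {m : ℕ} (n : ℕ) (α q : ℝ) (p : Fin m → ℝ) (β : ℝ) (C : ℝ≥0) : Prop :=
  ∀ w : Fin m → (Fin n → ℝ) → ℝ, MemApq p q w →
    ∀ f : Fin m → (Fin n → ℝ) → ℂ, MemSource p w f →
      eLpNorm (maximalFn α f) (ENNReal.ofReal q) (targetMeasure q w) ≤
        C * apqConst p q w ^ β *
          ∏ i, eLpNorm (f i) (ENNReal.ofReal (p i)) (sourceMeasure p w i)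

end MultiFrac

end

/-!
The upper bound is proved for dyadic grids by a sparse domination argument and then transferred to all
cubes. Write `τ = α/n`, `d = m - τ`, `θ = p'_{i₀} (1 - τ)`, and `F(Q) = |Q|^{-d} ∏ ∫_Q |fᵢ|`, so that
`M_α f(x)` is the supremum of `F(Q)` over the cubes containing `x`.

*Dyadic bound.* Descending through a nested sequence of partitions, one stops whenever `F` exceeds
`2 ^ d` times its value on the previous stopping piece. Since `F(Q)^{1/d} |Q|` is superadditive, the
stopping pieces are sparse: the part `E_Q` of `Q` not covered by later ones has at least half of its
measure (`NestedPartition.measure_cell_le_two_mul`). Hence `∫ (M f)^q u` is at most a constant times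
`∑ F(Q)^q u(Q)` over the stopping pieces. Put `fᵢ = gᵢ σᵢ`, and let `⟨gᵢ⟩` be the average of `gᵢ` over
`Q` with respect to `σᵢ`. The `A_{P,q}` condition raised to the power `θ`, together with Hölder's
inequality `|E|^d ≤ u(E)^{1/q} ∏ σᵢ(E)^{1/pᵢ'}` on `E_Q`, gives
`F(Q)^q u(Q) ≤ C [w]^θ σ_{i₀}(Q)^{qτ} ∏ ⟨gᵢ⟩^q σᵢ(E_Q)^{cᵢ}`, where `cᵢ = q/pᵢ` except that
`c_{i₀} = q/p_{i₀} - qτ` (`mass_le`); the hypothesis `pᵢ' ≤ θ` for `i ≠ i₀` makes the masses of `Q`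
occur with negative exponents, so that they may be replaced by those of `E_Q`. Jensen's inequality
absorbs `σ_{i₀}(Q)^{qτ}` into `‖g_{i₀}‖^{p_{i₀} qτ}`, and since `∑ cᵢ = 1` and the `E_Q` are disjoint,
Hölder's inequality for sums leaves the maximal functions of the averages of `gᵢ` in `L^{pᵢ}(σᵢ)`, which
are bounded with constants independent of `σᵢ` (`NestedPartition.lintegral_maxAvg_rpow_le`).

*All cubes.* By the one-third trick every cube of a bounded range of scales lies in a cell of comparable
size of one of `2 ^ n` translated dyadic grids (`exists_cube_subset_cell`); then the range of scales is
let grow. If `u_w` is not almost everywhere zero, finiteness of `[w]` makes all the masses `σᵢ(Q)` and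
`u_w(Q)` finite and the weights positive almost everywhere, as the argument requires.

*Sharpness.* For `w_{i₀} = |x|^{(n-ε)/p'_{i₀}}` and `wᵢ = 1` otherwise, `[w]` is at most of order
`ε^{-q/p'_{i₀}}`. With `f_{i₀} = |x|^{ε-n}` and `fᵢ = |x|^{ε-n/pᵢ}` on the unit ball, the product of the
norms is at most of order `ε^{-∑ 1/pᵢ}`, while `‖M_α f‖` is at least of order `ε^{-1-1/q}`. Since
`1 + 1/q - ∑ 1/pᵢ = 1 - τ`, letting `ε` tend to zero excludes every smaller exponent.
-/

namespace MultiFrac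

/-! ### Nested partitions and maximal functions of averages -/

theorem tsum_prod_rpow_le {I ι : Type*} [Fintype ι] (f : ι → I → ℝ≥0∞) (c : ι → ℝ)
    (hc : ∑ i, c i = 1) (h0 : ∀ i, 0 ≤ c i) :
    ∑' s, ∏ i, f i s ^ c i ≤ ∏ i, (∑' s, f i s) ^ c i := by
  let _ : MeasurableSpace I := ⊤
  have : MeasurableSingletonClass I := ⟨fun _ => trivial⟩
  have h := ENNReal.lintegral_prod_norm_pow_le (μ := (Measure.count : Measure I)) Finset.univ
    (f := f) (fun i _ => (measurable_from_top (f := f i)).aemeasurable) hc (fun i _ => h0 i)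
  simpa [lintegral_count] using h

theorem tsum_rpow_le {I : Type*} (f : I → ℝ≥0∞) {S : ℝ} (hS : 1 ≤ S) :
    ∑' s, f s ^ S ≤ (∑' s, f s) ^ S := by
  have hsplit : ∀ y : ℝ≥0∞, y ^ S = y * y ^ (S - 1) := fun y => by
    conv_lhs => rw [show S = 1 + (S - 1) by ring,
      ENNReal.rpow_add_of_nonneg _ _ zero_le_one (by linarith), ENNReal.rpow_one]
  calc ∑' s, f s ^ S ≤ ∑' s, f s * (∑' s, f s) ^ (S - 1) := by
        refine ENNReal.tsum_le_tsum fun s => ?_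
        rw [hsplit]
        exact mul_le_mul_right (ENNReal.rpow_le_rpow (ENNReal.le_tsum s) (by linarith)) _
    _ = (∑' s, f s) ^ S := by rw [ENNReal.tsum_mul_right, ← hsplit]

/-- Superadditivity of `(∏ᵢ νᵢ) ^ c` when the total exponent `c · #ι` is at least one. -/
theorem tsum_prod_rpow_le_of_one_le {I ι : Type*} [Fintype ι] [Nonempty ι] (f : ι → I → ℝ≥0∞)
    {c : ℝ} (hc : 1 ≤ Fintype.card ι * c) :
    ∑' s, (∏ i, f i s) ^ c ≤ (∏ i, ∑' s, f i s) ^ c := by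
  have hm : (0 : ℝ) < Fintype.card ι := by exact_mod_cast Fintype.card_pos
  set N : ℝ := (Fintype.card ι : ℝ) with hN
  have hc0 : 0 ≤ N * c := by linarith
  have hpow : ∀ x : ι → ℝ≥0∞, (∏ i, x i) ^ c = (∏ i, x i ^ (1 / N)) ^ (N * c) := fun x => by
    rw [ENNReal.prod_rpow_of_nonneg (by positivity), ← ENNReal.rpow_mul]
    congr 1
    field_simp
  simp_rw [hpow]
  refine (tsum_rpow_le _ hc).trans (ENNReal.rpow_le_rpow ?_ hc0)
  refine tsum_prod_rpow_le f (fun _ => 1 / N) ?_ (fun _ => by positivity)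
  simp [← hN, hm.ne']

/-- A nested sequence of countable partitions of `X`, getting finer with the level `i`; the piece
containing `x` is the fibre of `label i` through `x`. -/
structure NestedPartition (X J : Type*) [MeasurableSpace X] where
  /-- The name of the piece of level `i` containing `x`. -/
  label : ℕ → X → J
  measurableSet_fiber : ∀ i j, MeasurableSet (label i ⁻¹' {j})
  nested : ∀ i x y, label (i + 1) x = label (i + 1) y → label i x = label i y

namespace NestedPartition

variable {X J : Type*} [MeasurableSpace X] (D : NestedPartition X J)

/-- The piece of level `i` containing `x`. -/
def cell (i : ℕ) (x : X) : Set X := {y | D.label i y = D.label i x}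

theorem cell_congr {i : ℕ} {x y : X} (h : D.label i x = D.label i y) : D.cell i x = D.cell i y := by
  simp [cell, h]

theorem cell_eq_of_mem {i : ℕ} {x y : X} (h : y ∈ D.cell i x) : D.cell i y = D.cell i x :=
  D.cell_congr h

theorem measurableSet_cell (i : ℕ) (x : X) : MeasurableSet (D.cell i x) :=
  D.measurableSet_fiber i _

theorem label_eq_of_le {i k : ℕ} (hik : i ≤ k) {x y : X} (h : D.label k x = D.label k y) :
    D.label i x = D.label i y := by
  induction k, hik using Nat.le_induction with
  | base => exact h
  | succ k _ ih => exact ih (D.nested _ _ _ h)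

theorem cell_subset_cell {i k : ℕ} (hik : i ≤ k) (x : X) : D.cell k x ⊆ D.cell i x :=
  fun _ hy => D.label_eq_of_le hik hy

theorem measurableSet_of_label [Countable J] {i : ℕ} {A : Set X}
    (h : ∀ x y, D.label i x = D.label i y → x ∈ A → y ∈ A) : MeasurableSet A := by
  have hA : A = ⋃ j ∈ D.label i '' A, D.label i ⁻¹' {j} := by
    ext y
    simp only [Set.mem_image, Set.iUnion_exists, Set.biUnion_and', Set.iUnion_iUnion_eq_right,
      Set.mem_iUnion, Set.mem_preimage, Set.mem_singleton_iff, exists_prop]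
    exact ⟨fun hy => ⟨y, hy, rfl⟩, fun ⟨x, hx, hxy⟩ => h x y hxy.symm hx⟩
  rw [hA]
  exact MeasurableSet.biUnion (Set.to_countable _) fun j _ => D.measurableSet_fiber i j

theorem measurable_of_label [Countable J] {Y : Type*} [MeasurableSpace Y] {i : ℕ} {g : X → Y}
    (h : ∀ x y, D.label i x = D.label i y → g x = g y) : Measurable g := fun S _ =>
  D.measurableSet_of_label (i := i) fun x y hxy hx => by
    simpa only [Set.mem_preimage, ← h x y hxy] using hx

/-- A stopping-time covering estimate. The set where some `B i`, `i ≥ k`, holds is the disjoint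
union of the first (that is, largest) pieces on which it holds, so a superadditive `Φ` dominating
`μ` on these pieces dominates `μ` of the whole set. -/
theorem measure_exists_le [Countable J] (μ : Measure X) (Φ : Set X → ℝ≥0∞)
    (hmono : ∀ A B : Set X, A ⊆ B → Φ A ≤ Φ B)
    (hsup : ∀ A : ℕ × J → Set X, (∀ s, MeasurableSet (A s)) → Pairwise (Function.onFun Disjoint A) →
      ∑' s, Φ (A s) ≤ Φ (⋃ s, A s))
    (B : ℕ → X → Prop) (hB : ∀ i x y, D.label i x = D.label i y → B i x → B i y)
    (hμ : ∀ i x, B i x → μ (D.cell i x) ≤ Φ (D.cell i x))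
    (k : ℕ) (Q : Set X) (hQ : ∀ x ∈ Q, ∀ i, k ≤ i → D.cell i x ⊆ Q) :
    μ {x | x ∈ Q ∧ ∃ i, k ≤ i ∧ B i x} ≤ Φ Q := by
  classical
  let A : ℕ × J → Set X := fun s =>
    {x | x ∈ Q ∧ k ≤ s.1 ∧ B s.1 x ∧ (∀ i, k ≤ i → i < s.1 → ¬ B i x) ∧ D.label s.1 x = s.2}
  have hsat : ∀ s x, x ∈ A s → A s = D.cell s.1 x := by
    rintro ⟨i, j⟩ x ⟨hxQ, hk, hBx, hfirst, hj⟩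
    ext y
    constructor
    · rintro ⟨-, -, -, -, hy⟩
      exact hy.trans hj.symm
    · intro hy
      refine ⟨hQ x hxQ i hk hy, hk, hB i x y hy.symm hBx, fun i' hk' hi' hBy => ?_, ?_⟩
      · exact hfirst i' hk' hi' (hB i' y x (D.label_eq_of_le hi'.le hy) hBy)
      · exact Eq.trans hy hj
  have hmeas : ∀ s, MeasurableSet (A s) := fun s => by
    rcases (A s).eq_empty_or_nonempty with h | ⟨x, hx⟩
    · rw [h]; exact MeasurableSet.empty
    · rw [hsat s x hx]; exact D.measurableSet_cell _ _
  have hdisj : Pairwise (Function.onFun Disjoint A) := by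
    rintro ⟨i, j⟩ ⟨i', j'⟩ hne
    refine Set.disjoint_left.2 fun x hx hx' => hne ?_
    obtain ⟨-, hk, hBx, hf, hj⟩ := hx
    obtain ⟨-, hk', hBx', hf', hj'⟩ := hx'
    have hi : i = i' := by
      rcases lt_trichotomy i i' with h | h | h
      · exact absurd hBx (hf' i hk h)
      · exact h
      · exact absurd hBx' (hf i' hk' h)
    subst hi
    exact Prod.ext rfl (hj.symm.trans hj')
  have hle : ∀ s, μ (A s) ≤ Φ (A s) := fun s => by
    rcases (A s).eq_empty_or_nonempty with h | ⟨x, hx⟩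
    · rw [h, measure_empty]; exact zero_le
    · rw [hsat s x hx]; exact hμ _ _ hx.2.2.1
  have hcov : {x | x ∈ Q ∧ ∃ i, k ≤ i ∧ B i x} ⊆ ⋃ s, A s := by
    rintro x ⟨hxQ, hex⟩
    have hspec := Nat.find_spec hex
    exact Set.mem_iUnion.2 ⟨(Nat.find hex, D.label (Nat.find hex) x), hxQ, hspec.1, hspec.2,
      fun i hk hi hBi => Nat.find_min hex hi ⟨hk, hBi⟩, rfl⟩
  calc μ {x | x ∈ Q ∧ ∃ i, k ≤ i ∧ B i x} ≤ μ (⋃ s, A s) := measure_mono hcov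
    _ ≤ ∑' s, μ (A s) := measure_iUnion_le _
    _ ≤ ∑' s, Φ (A s) := ENNReal.tsum_le_tsum hle
    _ ≤ Φ (⋃ s, A s) := hsup A hmeas hdisj
    _ ≤ Φ Q := hmono _ _ (Set.iUnion_subset fun s x hx => hx.1)

end NestedPartition

/-- The layer cake formula for an extended nonnegative function that is finite almost everywhere. -/
theorem lintegral_rpow_eq_lintegral_meas_lt {X : Type*} [MeasurableSpace X] (ν : Measure X)
    {g : X → ℝ≥0∞} (hg : Measurable g) (hfin : ∀ᵐ x ∂ν, g x < ∞) {p : ℝ} (hp : 0 < p) :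
    ∫⁻ x, g x ^ p ∂ν = ENNReal.ofReal p *
      ∫⁻ t in Set.Ioi (0 : ℝ), ν {x | ENNReal.ofReal t < g x} * ENNReal.ofReal (t ^ (p - 1)) := by
  have h := lintegral_rpow_eq_lintegral_meas_lt_mul ν (f := fun x => (g x).toReal)
    (Filter.Eventually.of_forall fun x => ENNReal.toReal_nonneg) hg.ennreal_toReal.aemeasurable hp
  have hL : ∫⁻ x, g x ^ p ∂ν = ∫⁻ x, ENNReal.ofReal ((g x).toReal ^ p) ∂ν := by
    refine lintegral_congr_ae ?_
    filter_upwards [hfin] with x hx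
    rw [← ENNReal.ofReal_rpow_of_nonneg ENNReal.toReal_nonneg hp.le, ENNReal.ofReal_toReal hx.ne]
  rw [hL, h]
  congr 1
  refine setLIntegral_congr_fun measurableSet_Ioi fun t ht => ?_
  congr 1
  refine measure_congr ?_
  filter_upwards [hfin] with x hx
  exact propext (ENNReal.ofReal_lt_iff_lt_toReal (le_of_lt ht) hx.ne).symm

/-- Marcinkiewicz interpolation, in the form used for maximal functions: the truncated weak type
inequality `t ν{N > t} ≤ 2 ∫_{2g > t} g` implies the strong type inequality in `L^p`, `p > 1`. -/
theorem lintegral_rpow_le_of_weak_type {X : Type*} [MeasurableSpace X] (ν : Measure X)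
    {N g : X → ℝ≥0∞} (hN : Measurable N) (hg : Measurable g) (hNfin : ∀ x, N x < ∞)
    {p : ℝ} (hp : 1 < p)
    (hweak : ∀ t : ℝ, 0 < t → ENNReal.ofReal t * ν {x | ENNReal.ofReal t < N x} ≤
      2 * ∫⁻ x in {x | ENNReal.ofReal t < 2 * g x}, g x ∂ν)
    (hgp : ∫⁻ x, g x ^ p ∂ν < ∞) :
    ∫⁻ x, N x ^ p ∂ν ≤
      ENNReal.ofReal p * 2 * (ENNReal.ofReal (p - 1))⁻¹ * 2 ^ (p - 1) * ∫⁻ x, g x ^ p ∂ν := by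
  have hp0 : 0 < p := by linarith
  have hp1 : 0 < p - 1 := by linarith
  have hgfin : ∀ᵐ x ∂ν, g x < ∞ := by
    filter_upwards [ae_lt_top (hg.pow_const p) hgp.ne] with x hx
    exact (ENNReal.rpow_lt_top_iff_of_pos hp0).1 hx
  have hgfin' : ∀ᵐ x ∂(ν.withDensity g), 2 * g x < ∞ := by
    refine (withDensity_absolutelyContinuous ν g).ae_le ?_
    filter_upwards [hgfin] with x hx
    exact ENNReal.mul_lt_top (by simp) hx
  have hg2 : Measurable fun x => 2 * g x := hg.const_mul 2
  have hset : ∀ t : ℝ, MeasurableSet {x | ENNReal.ofReal t < 2 * g x} := fun t =>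
    measurableSet_lt measurable_const hg2
  have hcake := lintegral_rpow_eq_lintegral_meas_lt (ν.withDensity g) hg2 hgfin' hp1
  have hLHS : ∫⁻ x, (2 * g x) ^ (p - 1) ∂(ν.withDensity g) = 2 ^ (p - 1) * ∫⁻ x, g x ^ p ∂ν := by
    rw [lintegral_withDensity_eq_lintegral_mul _ hg (hg2.pow_const _),
      ← lintegral_const_mul _ (hg.pow_const p)]
    refine lintegral_congr fun x => ?_
    simp only [Pi.mul_apply]
    rw [ENNReal.mul_rpow_of_nonneg _ _ hp1.le, mul_left_comm]
    congr 1
    conv_rhs => rw [show p = 1 + (p - 1) by ring,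
      ENNReal.rpow_add_of_nonneg _ _ zero_le_one hp1.le, ENNReal.rpow_one]
  have hpne : ENNReal.ofReal (p - 1) ≠ 0 := by simpa using hp1
  rw [lintegral_rpow_eq_lintegral_meas_lt ν hN (Filter.Eventually.of_forall hNfin) hp0]
  have hstep : ∀ t ∈ Set.Ioi (0 : ℝ),
      ν {x | ENNReal.ofReal t < N x} * ENNReal.ofReal (t ^ (p - 1)) ≤
      2 * ((ν.withDensity g) {x | ENNReal.ofReal t < 2 * g x} *
        ENNReal.ofReal (t ^ (p - 1 - 1))) := by
    intro t ht
    have ht0 : 0 < t := ht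
    rw [withDensity_apply _ (hset t), ← mul_assoc]
    refine le_trans (le_of_eq ?_) (mul_le_mul_left (hweak t ht0) _)
    rw [mul_comm (ENNReal.ofReal t), mul_assoc, ← ENNReal.ofReal_mul ht0.le]
    congr 2
    conv_lhs => rw [show p - 1 = 1 + (p - 1 - 1) by ring, Real.rpow_add ht0, Real.rpow_one]
  calc ENNReal.ofReal p * ∫⁻ t in Set.Ioi (0 : ℝ),
        ν {x | ENNReal.ofReal t < N x} * ENNReal.ofReal (t ^ (p - 1))
      ≤ ENNReal.ofReal p * ∫⁻ t in Set.Ioi (0 : ℝ),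
        2 * ((ν.withDensity g) {x | ENNReal.ofReal t < 2 * g x} *
          ENNReal.ofReal (t ^ (p - 1 - 1))) := by
        gcongr 1
        exact setLIntegral_mono' measurableSet_Ioi hstep
    _ = ENNReal.ofReal p * 2 * ((ENNReal.ofReal (p - 1))⁻¹ * (ENNReal.ofReal (p - 1) *
        ∫⁻ t in Set.Ioi (0 : ℝ), (ν.withDensity g) {x | ENNReal.ofReal t < 2 * g x} *
          ENNReal.ofReal (t ^ (p - 1 - 1)))) := by
        rw [lintegral_const_mul' _ _ (by simp), ← mul_assoc (ENNReal.ofReal (p - 1))⁻¹,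
          ENNReal.inv_mul_cancel hpne ENNReal.ofReal_ne_top, one_mul, mul_assoc]
    _ = _ := by
        rw [← hcake, hLHS]
        ring

/-- The constant in the `L^p` bound of the dyadic maximal function. -/
noncomputable def maxAvgConst (p : ℝ) : ℝ≥0∞ :=
  ENNReal.ofReal p * 2 * (ENNReal.ofReal (p - 1))⁻¹ * 2 ^ (p - 1)

theorem maxAvgConst_ne_top {p : ℝ} (hp : 1 < p) : maxAvgConst p ≠ ∞ := by
  unfold maxAvgConst
  have : ENNReal.ofReal (p - 1) ≠ 0 := by simpa using hp
  refine ENNReal.mul_ne_top (ENNReal.mul_ne_top (ENNReal.mul_ne_top ENNReal.ofReal_ne_top (by simp))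
    (ENNReal.inv_ne_top.2 this)) (ENNReal.rpow_ne_top_of_nonneg (by linarith) (by simp))

namespace NestedPartition

variable {X J : Type*} [MeasurableSpace X] (D : NestedPartition X J)

/-- The maximal function of the averages over the first `K + 1` levels, for the measure `ν`. -/
noncomputable def maxAvg (ν : Measure X) (g : X → ℝ≥0∞) (K : ℕ) (x : X) : ℝ≥0∞ :=
  ⨆ i ∈ Finset.range (K + 1), (∫⁻ y in D.cell i x, g y ∂ν) / ν (D.cell i x)

theorem measurable_maxAvg [Countable J] (ν : Measure X) (g : X → ℝ≥0∞) (K : ℕ) :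
    Measurable (D.maxAvg ν g K) := by
  refine Measurable.biSup _ (Set.to_countable _) fun i _ => ?_
  exact D.measurable_of_label (i := i) fun x y h => by rw [D.cell_congr h]

theorem maxAvg_weak_type [Countable J] (ν : Measure X) {g : X → ℝ≥0∞} (hg : Measurable g) (K : ℕ)
    (hν : ∀ i x, ν (D.cell i x) ≠ ∞) {t : ℝ} (ht : 0 < t) :
    ENNReal.ofReal t * ν {x | ENNReal.ofReal t < D.maxAvg ν g K x} ≤
      2 * ∫⁻ x in {x | ENNReal.ofReal t < 2 * g x}, g x ∂ν := by
  set τ := ENNReal.ofReal t with hτ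
  have hτ0 : τ ≠ 0 := by simpa [hτ] using ht
  have hτt : τ ≠ ∞ := ENNReal.ofReal_ne_top
  set H := {x | τ < 2 * g x} with hHdef
  have hH : MeasurableSet H := measurableSet_lt measurable_const (hg.const_mul 2)
  set κ : Measure X := (ν.withDensity g).restrict H with hκ
  have hκA : ∀ A, MeasurableSet A → κ A = ∫⁻ y in A ∩ H, g y ∂ν := fun A hA => by
    rw [hκ, Measure.restrict_apply hA, withDensity_apply _ (hA.inter hH)]
  let B : ℕ → X → Prop := fun i x =>
    i ≤ K ∧ τ < (∫⁻ y in D.cell i x, g y ∂ν) / ν (D.cell i x)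
  have key := D.measure_exists_le ν (fun A => τ⁻¹ * (2 * κ A))
    (fun A A' h => by gcongr)
    (fun A hA hd => by
      rw [ENNReal.tsum_mul_left, ENNReal.tsum_mul_left, measure_iUnion hd hA]) B
    (fun i x y h hx => by
      simp only [B, ← D.cell_congr h]; exact hx)
    (fun i x hx => by
      have h1 : τ * ν (D.cell i x) ≤ ∫⁻ y in D.cell i x, g y ∂ν :=
        ENNReal.mul_le_of_le_div hx.2.le
      -- Off `H` the function is at most `τ / 2`, which accounts for only half of the average.
      have h2 : ∫⁻ y in D.cell i x, g y ∂ν ≤ κ (D.cell i x) + τ / 2 * ν (D.cell i x) := by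
        rw [← lintegral_inter_add_sdiff g (D.cell i x) hH, ← hκA _ (D.measurableSet_cell i x)]
        gcongr
        calc ∫⁻ y in D.cell i x \ H, g y ∂ν ≤ ∫⁻ y in D.cell i x \ H, τ / 2 ∂ν := by
              refine setLIntegral_mono' ((D.measurableSet_cell i x).diff hH) fun y hy => ?_
              have hy2 : ¬ τ < 2 * g y := hy.2
              rw [ENNReal.le_div_iff_mul_le (by simp) (by simp), mul_comm]
              exact not_lt.1 hy2
          _ = τ / 2 * ν (D.cell i x \ H) := by rw [setLIntegral_const]
          _ ≤ τ / 2 * ν (D.cell i x) := by gcongr; exact Set.sdiff_subset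
      have h3 : τ / 2 * ν (D.cell i x) + τ / 2 * ν (D.cell i x) ≤
          κ (D.cell i x) + τ / 2 * ν (D.cell i x) := by
        rw [← add_mul, ENNReal.add_halves]; exact h1.trans h2
      have hfin : τ / 2 * ν (D.cell i x) ≠ ∞ :=
        ENNReal.mul_ne_top (ENNReal.div_ne_top hτt (by simp)) (hν i x)
      have h4 : τ / 2 * ν (D.cell i x) ≤ κ (D.cell i x) :=
        (ENNReal.add_le_add_iff_right hfin).1 h3
      calc ν (D.cell i x) = τ⁻¹ * (2 * (τ / 2 * ν (D.cell i x))) := by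
            rw [← mul_assoc 2, ENNReal.mul_div_cancel (by simp) (by simp), ← mul_assoc,
              ENNReal.inv_mul_cancel hτ0 hτt, one_mul]
        _ ≤ _ := by gcongr)
    0 Set.univ (fun _ _ _ _ => Set.subset_univ _)
  have hsub : {x | τ < D.maxAvg ν g K x} ⊆ {x | x ∈ Set.univ ∧ ∃ i, 0 ≤ i ∧ B i x} := by
    intro x hx
    simp only [Set.mem_ofPred_eq, maxAvg, lt_iSup_iff, Finset.mem_range] at hx
    obtain ⟨i, hi, hx⟩ := hx
    exact ⟨trivial, i, Nat.zero_le _, Nat.lt_succ_iff.1 hi, hx⟩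
  calc τ * ν {x | τ < D.maxAvg ν g K x} ≤ τ * (τ⁻¹ * (2 * κ Set.univ)) := by
        gcongr; exact (measure_mono hsub).trans key
    _ = 2 * ∫⁻ x in H, g x ∂ν := by
        rw [← mul_assoc, ENNReal.mul_inv_cancel hτ0 hτt, one_mul, hκA _ MeasurableSet.univ,
          Set.univ_inter]

/-- The maximal function of averages is bounded on `L^p(ν)`, `p > 1`, with a constant that does not
depend on `ν`. -/
theorem lintegral_maxAvg_rpow_le [Countable J] (ν : Measure X) {g : X → ℝ≥0∞} (hg : Measurable g)
    (K : ℕ) (hν0 : ∀ i x, ν (D.cell i x) ≠ 0) (hν : ∀ i x, ν (D.cell i x) ≠ ∞)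
    (hfin : ∀ i x, ∫⁻ y in D.cell i x, g y ∂ν ≠ ∞) {p : ℝ} (hp : 1 < p)
    (hgp : ∫⁻ x, g x ^ p ∂ν < ∞) :
    ∫⁻ x, D.maxAvg ν g K x ^ p ∂ν ≤ maxAvgConst p * ∫⁻ x, g x ^ p ∂ν := by
  refine lintegral_rpow_le_of_weak_type ν (D.measurable_maxAvg ν g K) hg (fun x => ?_) hp
    (fun t ht => D.maxAvg_weak_type ν hg K hν ht) hgp
  unfold maxAvg
  refine (Finset.sup_eq_iSup _ _).symm.trans_lt ?_
  rw [Finset.sup_lt_iff (by simp)]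
  exact fun i _ => ENNReal.div_lt_top (hfin i x) (hν0 i x)

end NestedPartition

/-! ### Stopping pieces and sparseness -/

section Records

/-- The last index `i ≤ K` at which the sequence `s` exceeds `a` times its previous record value
(the initial index `0` counting as a record). -/
noncomputable def lastRecord (a : ℝ≥0∞) (s : ℕ → ℝ≥0∞) : ℕ → ℕ
  | 0 => 0
  | K + 1 => if a * s (lastRecord a s K) < s (K + 1) then K + 1 else lastRecord a s K

variable {a : ℝ≥0∞} {s t : ℕ → ℝ≥0∞}

theorem lastRecord_le (K : ℕ) : lastRecord a s K ≤ K := by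
  induction K with
  | zero => simp [lastRecord]
  | succ K ih => rw [lastRecord]; split_ifs <;> omega

theorem lastRecord_congr {K : ℕ} (h : ∀ i ≤ K, s i = t i) :
    lastRecord a s K = lastRecord a t K := by
  induction K with
  | zero => simp [lastRecord]
  | succ K ih =>
    have ih' := ih fun i hi => h i (by omega)
    rw [lastRecord, lastRecord, ← ih', h (K + 1) le_rfl,
      h (lastRecord a s K) ((lastRecord_le K).trans (Nat.le_succ K))]

theorem le_mul_lastRecord (ha : 1 ≤ a) {K i : ℕ} (hi : i ≤ K) :
    s i ≤ a * s (lastRecord a s K) := by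
  induction K with
  | zero =>
    obtain rfl : i = 0 := by omega
    exact le_mul_of_one_le_left' ha
  | succ K ih =>
    rw [lastRecord]
    split_ifs with h
    · rcases Nat.lt_or_ge i (K + 1) with hi' | hi'
      · exact (ih (by omega)).trans (h.le.trans (le_mul_of_one_le_left' ha))
      · obtain rfl : i = K + 1 := by omega
        exact le_mul_of_one_le_left' ha
    · rcases Nat.lt_or_ge i (K + 1) with hi' | hi'
      · exact ih (by omega)
      · obtain rfl : i = K + 1 := by omega
        exact not_lt.1 h

theorem lastRecord_lastRecord (K : ℕ) :
    lastRecord a s (lastRecord a s K) = lastRecord a s K := by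
  induction K with
  | zero => simp [lastRecord]
  | succ K ih =>
    by_cases h : a * s (lastRecord a s K) < s (K + 1)
    · have h' : lastRecord a s (K + 1) = K + 1 := by rw [lastRecord, if_pos h]
      rw [h', h']
    · have h' : lastRecord a s (K + 1) = lastRecord a s K := by rw [lastRecord, if_neg h]
      rw [h', ih]

theorem exists_lt_of_lastRecord_ne {i K : ℕ} (hi : lastRecord a s i = i) (hiK : i ≤ K)
    (hne : lastRecord a s K ≠ i) : ∃ k, i ≤ k ∧ k ≤ K ∧ a * s i < s k := by
  induction K, hiK using Nat.le_induction with
  | base => exact absurd hi hne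
  | succ K hiK ih =>
    by_cases hK : lastRecord a s K = i
    · rw [lastRecord, hK] at hne
      split_ifs at hne with h
      · exact ⟨K + 1, by omega, le_rfl, h⟩
      · exact absurd rfl hne
    · obtain ⟨k, hk, hkK, hlt⟩ := ih hK
      exact ⟨k, hk, by omega, hlt⟩

end Records

/-- The multilinear fractional average `μ(Q) ^ (-d) ∏ₖ νₖ(Q)`. -/
noncomputable def fracAvg {X ι : Type*} [MeasurableSpace X] [Fintype ι] (μ : Measure X)
    (ν : ι → Measure X) (d : ℝ) (Q : Set X) : ℝ≥0∞ :=
  (∏ k, ν k Q) / μ Q ^ d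

namespace NestedPartition

variable {X J ι : Type*} [MeasurableSpace X] (D : NestedPartition X J) [Fintype ι]

/-- The multilinear fractional maximal function over the first `K + 1` levels. -/
noncomputable def maxFracAvg (μ : Measure X) (ν : ι → Measure X) (d : ℝ) (K : ℕ) (x : X) : ℝ≥0∞ :=
  ⨆ i ∈ Finset.range (K + 1), fracAvg μ ν d (D.cell i x)

/-- The level of the last stopping piece through `x`: starting at the coarsest level, one stops
whenever the fractional average exceeds `2 ^ d` times its value on the previous stopping piece. -/
noncomputable def stopLevel (μ : Measure X) (ν : ι → Measure X) (d : ℝ) (K : ℕ) (x : X) : ℕ :=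
  lastRecord (2 ^ d) (fun i => fracAvg μ ν d (D.cell i x)) K

theorem stopLevel_congr (μ : Measure X) (ν : ι → Measure X) (d : ℝ) {K : ℕ} {x y : X}
    (h : D.label K x = D.label K y) : D.stopLevel μ ν d K x = D.stopLevel μ ν d K y :=
  lastRecord_congr fun _ hi => by rw [D.cell_congr (D.label_eq_of_le hi h)]

/-- Sparseness of the stopping pieces: at least half of a stopping piece of level `i` is not covered
by stopping pieces of finer levels. -/
theorem measure_cell_le_two_mul [Countable J] [Nonempty ι] (μ : Measure X) (ν : ι → Measure X)
    {d : ℝ} (hd : 0 < d) (hdι : d ≤ Fintype.card ι)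
    (hμ0 : ∀ i x, μ (D.cell i x) ≠ 0) (hμ : ∀ i x, μ (D.cell i x) ≠ ∞)
    (hν : ∀ k i x, ν k (D.cell i x) ≠ ∞) {i K : ℕ} (hiK : i ≤ K) {x : X}
    (hlevel : D.stopLevel μ ν d i x = i) (hF : fracAvg μ ν d (D.cell i x) ≠ 0) :
    μ (D.cell i x) ≤ 2 * μ (D.cell i x ∩ {y | D.stopLevel μ ν d K y = i}) := by
  set Q := D.cell i x with hQ
  have hμd0 : ∀ i x, μ (D.cell i x) ^ d ≠ 0 := fun i x h => by
    rcases ENNReal.rpow_eq_zero_iff.1 h with h | h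
    · exact hμ0 i x h.1
    · exact hμ i x h.1
  have hμd : ∀ i x, μ (D.cell i x) ^ d ≠ ∞ := fun i x =>
    ENNReal.rpow_ne_top_of_nonneg hd.le (hμ i x)
  have hFtop : fracAvg μ ν d Q ≠ ∞ :=
    ENNReal.div_ne_top (ENNReal.prod_ne_top fun k _ => hν k i x) (hμd0 i x)
  set F := fracAvg μ ν d Q with hFdef
  have h2d0 : (2 : ℝ≥0∞) ^ d ≠ 0 := by simp [ENNReal.rpow_eq_zero_iff]
  have h2dt : (2 : ℝ≥0∞) ^ d ≠ ∞ := ENNReal.rpow_ne_top_of_nonneg hd.le (by simp)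
  set lam := (2 : ℝ≥0∞) ^ d * F with hlam
  have hlam0 : lam ≠ 0 := mul_ne_zero h2d0 hF
  have hlamt : lam ≠ ∞ := ENNReal.mul_ne_top h2dt hFtop
  have hinv : 0 ≤ 1 / d := by positivity
  let Φ : Set X → ℝ≥0∞ := fun A => (lam⁻¹) ^ (1 / d) * (∏ k, ν k A) ^ (1 / d)
  let B : ℕ → X → Prop := fun k y => k ≤ K ∧ lam < fracAvg μ ν d (D.cell k y)
  have hcancel : ∀ z : ℝ≥0∞, (z ^ d) ^ (1 / d) = z := fun z => by
    rw [← ENNReal.rpow_mul, mul_one_div_cancel hd.ne', ENNReal.rpow_one]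
  have key := D.measure_exists_le μ Φ
    (fun A A' h => by
      refine mul_le_mul_right (ENNReal.rpow_le_rpow ?_ hinv) _
      exact Finset.prod_le_prod' fun k _ => measure_mono h)
    (fun A hA hdj => by
      simp only [Φ]
      rw [ENNReal.tsum_mul_left]
      refine mul_le_mul_right ?_ _
      simp only [measure_iUnion hdj hA]
      refine tsum_prod_rpow_le_of_one_le (fun k s => ν k (A s)) ?_
      rw [mul_one_div]
      exact (one_le_div hd).2 hdι)
    B (fun k y z h hy => by simp only [B, ← D.cell_congr h]; exact hy)
    (fun k y hy => by
      have h1 : lam * μ (D.cell k y) ^ d ≤ ∏ k', ν k' (D.cell k y) :=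
        ENNReal.mul_le_of_le_div hy.2.le
      calc μ (D.cell k y) = (lam⁻¹ * (lam * μ (D.cell k y) ^ d)) ^ (1 / d) := by
            rw [← mul_assoc, ENNReal.inv_mul_cancel hlam0 hlamt, one_mul, hcancel]
        _ ≤ (lam⁻¹ * ∏ k', ν k' (D.cell k y)) ^ (1 / d) := by gcongr
        _ = _ := ENNReal.mul_rpow_of_nonneg _ _ hinv)
    i Q (fun y hy k hk => by
      rw [hQ, ← D.cell_eq_of_mem hy]
      exact D.cell_subset_cell hk y)
  have hΦQ : Φ Q = μ Q / 2 := by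
    have hprod : ∏ k, ν k Q = F * μ Q ^ d := by
      rw [hFdef, fracAvg, ENNReal.div_mul_cancel (hμd0 i x) (hμd i x)]
    have h1 : lam⁻¹ * (F * μ Q ^ d) = (μ Q / 2) ^ d := by
      rw [hlam, ENNReal.mul_inv (Or.inl h2d0) (Or.inl h2dt), mul_assoc,
        ← mul_assoc F⁻¹, ENNReal.inv_mul_cancel hF hFtop, one_mul,
        ENNReal.div_rpow_of_nonneg _ _ hd.le, mul_comm, div_eq_mul_inv]
    simp only [Φ]
    rw [hprod, ← ENNReal.mul_rpow_of_nonneg _ _ hinv, h1, hcancel]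
  have hcov : Q ⊆ {y | y ∈ Q ∧ ∃ k, i ≤ k ∧ B k y} ∪
      (Q ∩ {y | D.stopLevel μ ν d K y = i}) := by
    intro y hy
    by_cases hy' : D.stopLevel μ ν d K y = i
    · exact Or.inr ⟨hy, hy'⟩
    · left
      have hi : D.stopLevel μ ν d i y = i := by rw [D.stopLevel_congr μ ν d hy]; exact hlevel
      obtain ⟨k, hik, hkK, hlt⟩ := exists_lt_of_lastRecord_ne hi hiK hy'
      refine ⟨hy, k, hik, hkK, ?_⟩
      simpa only [D.cell_eq_of_mem hy] using hlt
  have hsum : μ Q / 2 + μ Q / 2 ≤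
      μ (Q ∩ {y | D.stopLevel μ ν d K y = i}) + μ Q / 2 := by
    rw [ENNReal.add_halves, add_comm, ← hΦQ]
    exact (measure_mono hcov).trans ((measure_union_le _ _).trans (by gcongr))
  have hhalf : μ Q / 2 ≤ μ (Q ∩ {y | D.stopLevel μ ν d K y = i}) :=
    (ENNReal.add_le_add_iff_right (ENNReal.div_ne_top (hμ i x) (by simp))).1 hsum
  calc μ Q = 2 * (μ Q / 2) := (ENNReal.mul_div_cancel (by simp) (by simp)).symm
    _ ≤ _ := by gcongr

end NestedPartition

/-- The exponents in Hölder's inequality over the stopping pieces: `q / pₖ`, lowered by `qτ` at the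
index `i₀`. They sum to one. -/
noncomputable def pieceExponent {ι : Type*} [DecidableEq ι] (q τ : ℝ) (p : ι → ℝ) (i₀ k : ι) : ℝ :=
  q / p k - if k = i₀ then q * τ else 0

theorem one_div_conj {p r : ℝ} (hpr : p.HolderConjugate r) : 1 / r = 1 - 1 / p := by
  have := hpr.inv_add_inv_eq_one
  simp only [one_div]; linarith

theorem pieceExponent_nonneg {ι : Type*} [DecidableEq ι] {q τ θ : ℝ} {p r : ι → ℝ} {i₀ : ι}
    (hq : 0 < q) (hpr : ∀ k, (p k).HolderConjugate (r k)) (hθ : θ = r i₀ * (1 - τ)) (hθ1 : 1 ≤ θ)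
    (k : ι) : 0 ≤ pieceExponent q τ p i₀ k := by
  unfold pieceExponent
  split_ifs with h
  · subst h
    have h1 := one_div_conj (hpr k)
    have hr : 0 < r k := (hpr k).symm.pos
    have hθr : θ * (1 / r k) = 1 - τ := by rw [hθ]; field_simp
    have h2 : 1 / p k - τ = (θ - 1) * (1 / r k) := by rw [sub_mul, hθr, h1]; ring
    have : q / p k - q * τ = q * (1 / p k - τ) := by ring
    rw [this, h2]; positivity
  · have := (hpr k).pos
    simp; positivity

section Exponents

variable {ι : Type*} [Fintype ι] [DecidableEq ι] {q τ θ : ℝ} {p r : ι → ℝ} {i₀ : ι}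

theorem sum_pieceExponent (hq : 0 < q) (hsum : ∑ k, 1 / p k = 1 / q + τ) :
    ∑ k, pieceExponent q τ p i₀ k = 1 := by
  simp only [pieceExponent, Finset.sum_sub_distrib, Finset.sum_ite_eq', Finset.mem_univ, if_true]
  have : ∑ k, q / p k = q * ∑ k, 1 / p k := by
    rw [Finset.mul_sum]; simp [div_eq_mul_inv]
  rw [this, hsum]
  field_simp
  ring

/-- The comparison of the masses of a stopping piece with those of its uncovered part, in
logarithmic form. -/
theorem log_mass_le (hq : 0 < q) (hpr : ∀ k, (p k).HolderConjugate (r k))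
    (hθ : θ = r i₀ * (1 - τ)) (hθ1 : 1 ≤ θ) (hgap : ∀ k, k ≠ i₀ → r k ≤ θ) {d : ℝ} (hd : 0 < d)
    {U U' v v' A b : ℝ} {s s' : ι → ℝ} (hU : U' ≤ U) (hs : ∀ k, s' k ≤ s k) (hv : v ≤ b + v')
    (hH : d * v' ≤ 1 / q * U' + ∑ k, 1 / r k * s' k)
    (hA : U + ∑ k, q / r k * s k ≤ A + q * d * v) :
    q * ∑ k, s k - d * q * v + U ≤
      d * q * (θ - 1) * b + θ * A + q * τ * s i₀ + ∑ k, pieceExponent q τ p i₀ k * s' k := by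
  have hθ0 : 0 < θ := by linarith
  -- The masses at each index: equality holds at `i₀`, where `θ / r = 1 - τ`, and `θ / r ≥ 1` elsewhere.
  have hk : ∀ k, (θ - 1) * (q * (1 / r k * s' k)) ≤ θ * (q / r k * s k) - q * s k
      + (if k = i₀ then q * τ * s k else 0) + pieceExponent q τ p i₀ k * s' k := by
    intro k
    have h1 := one_div_conj (hpr k)
    have hr : 0 < r k := (hpr k).symm.pos
    have hqr : q / r k = q * (1 / r k) := by ring
    have hqp : q / p k = q * (1 - 1 / r k) := by rw [h1]; ring
    unfold pieceExponent
    split_ifs with h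
    · subst h
      have h2 : θ * (1 / r k) = 1 - τ := by rw [hθ]; field_simp
      rw [hqr, hqp]
      have e1 : θ * (q * (1 / r k) * s k) = q * (θ * (1 / r k)) * s k := by ring
      have e2 : (θ - 1) * (q * (1 / r k * s' k)) =
          q * (θ * (1 / r k)) * s' k - q * (1 / r k) * s' k := by ring
      rw [e1, e2, h2]
      apply le_of_eq; ring
    · have h2 : 1 ≤ θ * (1 / r k) := by
        rw [mul_one_div]; exact (one_le_div hr).2 (hgap k h)
      rw [hqr, hqp]
      have h3 : 0 ≤ q * (θ * (1 / r k) - 1) * (s k - s' k) :=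
        mul_nonneg (mul_nonneg hq.le (by linarith)) (by linarith [hs k])
      linarith [h3]
  have hsum := Finset.sum_le_sum fun k (_ : k ∈ Finset.univ) => hk k
  simp only [Finset.sum_add_distrib, Finset.sum_sub_distrib, Finset.sum_ite_eq', Finset.mem_univ,
    if_true, ← Finset.mul_sum] at hsum
  have hA' := mul_le_mul_of_nonneg_left hA hθ0.le
  have hv' := mul_le_mul_of_nonneg_left hv (show 0 ≤ (θ - 1) * (q * d) from
    mul_nonneg (by linarith) (by positivity))
  have hH' := mul_le_mul_of_nonneg_left hH (show 0 ≤ (θ - 1) * q from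
    mul_nonneg (by linarith) hq.le)
  have hU' := mul_le_mul_of_nonneg_left hU (show 0 ≤ (θ - 1) by linarith)
  have e : (θ - 1) * q * (1 / q * U' + ∑ k, 1 / r k * s' k) =
      (θ - 1) * U' + (θ - 1) * (q * ∑ k, 1 / r k * s' k) := by
    field_simp
  rw [e] at hH'
  nlinarith [hsum, hA', hv', hH', hU']

end Exponents

/-! ### The weighted bound over nested partitions -/

theorem exists_eq_ofReal_exp {x : ℝ≥0∞} (h0 : x ≠ 0) (ht : x ≠ ∞) :
    ∃ l : ℝ, x = ENNReal.ofReal (Real.exp l) :=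
  ⟨Real.log x.toReal, by rw [Real.exp_log (ENNReal.toReal_pos h0 ht), ENNReal.ofReal_toReal ht]⟩

theorem ofReal_exp_rpow (l c : ℝ) :
    ENNReal.ofReal (Real.exp l) ^ c = ENNReal.ofReal (Real.exp (c * l)) := by
  rw [ENNReal.ofReal_rpow_of_pos (Real.exp_pos l), mul_comm, Real.exp_mul]

theorem ofReal_exp_mul (a b : ℝ) :
    ENNReal.ofReal (Real.exp a) * ENNReal.ofReal (Real.exp b) =
      ENNReal.ofReal (Real.exp (a + b)) := by
  rw [← ENNReal.ofReal_mul (Real.exp_pos a).le, Real.exp_add]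

theorem prod_ofReal_exp {ι : Type*} [Fintype ι] (l : ι → ℝ) :
    ∏ k, ENNReal.ofReal (Real.exp (l k)) = ENNReal.ofReal (Real.exp (∑ k, l k)) := by
  rw [Real.exp_sum, ENNReal.ofReal_prod_of_nonneg fun k _ => (Real.exp_pos _).le]

theorem ofReal_exp_le_iff {a b : ℝ} :
    ENNReal.ofReal (Real.exp a) ≤ ENNReal.ofReal (Real.exp b) ↔ a ≤ b := by
  rw [ENNReal.ofReal_le_ofReal_iff (Real.exp_pos b).le, Real.exp_le_exp]

/-- The comparison of the masses of a stopping piece (`U`, `s`, `v`) with those of its uncovered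
part (`U'`, `s'`, `v'`). Here `hA` is the `A_{P,q}` condition, and `hH` is Hölder's inequality on the
uncovered part. -/
theorem mass_le {ι : Type*} [Fintype ι] [DecidableEq ι] {q τ θ : ℝ} {p r : ι → ℝ} {i₀ : ι}
    (hq : 0 < q) (hpr : ∀ k, (p k).HolderConjugate (r k))
    (hθ : θ = r i₀ * (1 - τ)) (hθ1 : 1 ≤ θ) (hgap : ∀ k, k ≠ i₀ → r k ≤ θ) {d : ℝ} (hd : 0 < d)
    {U U' v v' A : ℝ≥0∞} {s s' : ι → ℝ≥0∞} (hUt : U ≠ ∞) (hst : ∀ k, s k ≠ ∞)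
    (hv0 : v ≠ 0) (hvt : v ≠ ∞) (hAt : A ≠ ∞)
    (hU : U' ≤ U) (hs : ∀ k, s' k ≤ s k) (hv' : v' ≤ v) (hv : v ≤ 2 * v')
    (hH : v' ^ d ≤ U' ^ (1 / q) * ∏ k, s' k ^ (1 / r k))
    (hA : U * ∏ k, s k ^ (q / r k) ≤ A * v ^ (q * d)) :
    (∏ k, s k) ^ q * U ≤ 2 ^ (d * q * (θ - 1)) * A ^ θ * s i₀ ^ (q * τ) *
      (∏ k, s' k ^ pieceExponent q τ p i₀ k) * v ^ (d * q) := by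
  have hv'0 : v' ≠ 0 := by
    rintro rfl; simp at hv; exact hv0 hv
  have hr : ∀ k, 0 < r k := fun k => (hpr k).symm.pos
  have hvd : v' ^ d ≠ 0 := by
    simp only [ne_eq, ENNReal.rpow_eq_zero_iff, not_or, not_and]
    exact ⟨fun h => absurd h hv'0, fun _ => hd.not_gt⟩
  have hR : U' ^ (1 / q) * ∏ k, s' k ^ (1 / r k) ≠ 0 := fun h => hvd (le_zero_iff.1 (h ▸ hH))
  have hU'0 : U' ≠ 0 := fun h => hR (by rw [h, ENNReal.zero_rpow_of_pos (by positivity), zero_mul])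
  have hs'0 : ∀ k, s' k ≠ 0 := fun k h => hR <| by
    rw [Finset.prod_eq_zero (Finset.mem_univ k), mul_zero]
    rw [h, ENNReal.zero_rpow_of_pos (one_div_pos.2 (hr k))]
  have hU0 : U ≠ 0 := fun h => hU'0 (le_zero_iff.1 (h ▸ hU))
  have hs0 : ∀ k, s k ≠ 0 := fun k h => hs'0 k (le_zero_iff.1 (h ▸ hs k))
  have hU't : U' ≠ ∞ := ne_top_of_le_ne_top hUt hU
  have hs't : ∀ k, s' k ≠ ∞ := fun k => ne_top_of_le_ne_top (hst k) (hs k)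
  have hA0 : A ≠ 0 := by
    rintro rfl
    rw [zero_mul, le_zero_iff, mul_eq_zero, Finset.prod_eq_zero_iff] at hA
    rcases hA with h | ⟨k, -, h⟩
    · exact hU0 h
    · rcases ENNReal.rpow_eq_zero_iff.1 h with h | h
      · exact hs0 k h.1
      · exact hst k h.1
  obtain ⟨lU, rfl⟩ := exists_eq_ofReal_exp hU0 hUt
  obtain ⟨lU', rfl⟩ := exists_eq_ofReal_exp hU'0 hU't
  obtain ⟨lv, rfl⟩ := exists_eq_ofReal_exp hv0 hvt
  obtain ⟨lv', rfl⟩ := exists_eq_ofReal_exp hv'0 (ne_top_of_le_ne_top hvt hv')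
  obtain ⟨lA, rfl⟩ := exists_eq_ofReal_exp hA0 hAt
  choose ls hls using fun k => exists_eq_ofReal_exp (hs0 k) (hst k)
  choose ls' hls' using fun k => exists_eq_ofReal_exp (hs'0 k) (hs't k)
  have h2 : (2 : ℝ≥0∞) = ENNReal.ofReal (Real.exp (Real.log 2)) := by
    rw [Real.exp_log (by norm_num)]; simp
  simp only [hls, hls', h2, ofReal_exp_rpow, ofReal_exp_mul, prod_ofReal_exp,
    ofReal_exp_le_iff] at *
  have := log_mass_le hq hpr hθ hθ1 hgap hd hU hs hv hH hA
  linarith only [this]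

/-- Jensen's inequality for the average of a nonnegative function over a set. -/
theorem average_rpow_mul_le {X : Type*} [MeasurableSpace X] (ν : Measure X) {g : X → ℝ≥0∞}
    (hg : Measurable g) {Q : Set X} (hν0 : ν Q ≠ 0) (hν : ν Q ≠ ∞) {p : ℝ} (hp : 1 < p) :
    ((∫⁻ x in Q, g x ∂ν) / ν Q) ^ p * ν Q ≤ ∫⁻ x, g x ^ p ∂ν := by
  have hp0 : 0 < p := by linarith
  have hpq := Real.HolderConjugate.conjExponent hp
  have h := ENNReal.lintegral_mul_le_Lp_mul_Lq (ν.restrict Q) hpq hg.aemeasurable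
    (aemeasurable_const (b := (1 : ℝ≥0∞)))
  simp only [Pi.mul_apply, mul_one, ENNReal.one_rpow, lintegral_const, Measure.restrict_apply_univ,
    one_mul] at h
  have h2 : (∫⁻ x in Q, g x ∂ν) ^ p ≤ (∫⁻ x in Q, g x ^ p ∂ν) * ν Q ^ (p - 1) := by
    calc (∫⁻ x in Q, g x ∂ν) ^ p
        ≤ ((∫⁻ x in Q, g x ^ p ∂ν) ^ (1 / p) * ν Q ^ (1 / p.conjExponent)) ^ p := by gcongr
      _ = _ := by
        rw [ENNReal.mul_rpow_of_nonneg _ _ hp0.le, ← ENNReal.rpow_mul, ← ENNReal.rpow_mul,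
          one_div_mul_cancel hp0.ne', ENNReal.rpow_one]
        congr 2
        rw [one_div_conj hpq]
        field_simp
  calc ((∫⁻ x in Q, g x ∂ν) / ν Q) ^ p * ν Q
      = (∫⁻ x in Q, g x ∂ν) ^ p * (ν Q ^ (-p) * ν Q) := by
        rw [ENNReal.div_rpow_of_nonneg _ _ hp0.le, ENNReal.div_eq_inv_mul, ENNReal.rpow_neg]
        ring
    _ ≤ (∫⁻ x in Q, g x ^ p ∂ν) * ν Q ^ (p - 1) * (ν Q ^ (-p) * ν Q) := by gcongr
    _ = (∫⁻ x in Q, g x ^ p ∂ν) * (ν Q ^ (p - 1) * (ν Q ^ (-p) * ν Q ^ (1 : ℝ))) := by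
        rw [ENNReal.rpow_one, mul_assoc]
    _ = ∫⁻ x in Q, g x ^ p ∂ν := by
        rw [← ENNReal.rpow_add _ _ hν0 hν, ← ENNReal.rpow_add _ _ hν0 hν]
        simp
    _ ≤ ∫⁻ x, g x ^ p ∂ν := setLIntegral_le_lintegral _ _

namespace NestedPartition

variable {X J ι : Type*} [MeasurableSpace X] (D : NestedPartition X J) [Fintype ι]

/-- Up to the factor `2 ^ d`, the maximal function is attained on the last stopping piece. -/
theorem maxFracAvg_le_stopLevel (μ : Measure X) (ν : ι → Measure X) {d : ℝ} (hd : 0 < d) (K : ℕ)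
    (x : X) : D.maxFracAvg μ ν d K x ≤
      2 ^ d * fracAvg μ ν d (D.cell (D.stopLevel μ ν d K x) x) := by
  refine iSup₂_le fun i hi => ?_
  exact le_mul_lastRecord (s := fun i => fracAvg μ ν d (D.cell i x))
    (ENNReal.one_le_rpow (by norm_num) hd) (Nat.lt_succ_iff.1 (Finset.mem_range.1 hi))

/-- The part of the piece of level `s.1` and label `s.2` on which `s.1` is the last stopping
level. -/
def stopPart (μ : Measure X) (ν : ι → Measure X) (d : ℝ) (K : ℕ) (s : ℕ × J) : Set X :=
  {x | D.stopLevel μ ν d K x = s.1 ∧ D.label s.1 x = s.2}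

theorem measurableSet_stopLevel [Countable J] (μ : Measure X) (ν : ι → Measure X) (d : ℝ) (K i : ℕ) :
    MeasurableSet {x | D.stopLevel μ ν d K x = i} :=
  D.measurableSet_of_label (i := K) fun _ _ h hx => (D.stopLevel_congr μ ν d h).symm.trans hx

theorem measurableSet_stopPart [Countable J] (μ : Measure X) (ν : ι → Measure X) (d : ℝ) (K : ℕ)
    (s : ℕ × J) : MeasurableSet (D.stopPart μ ν d K s) :=
  (D.measurableSet_stopLevel μ ν d K s.1).inter (D.measurableSet_fiber s.1 s.2)

theorem pairwise_disjoint_stopPart (μ : Measure X) (ν : ι → Measure X) (d : ℝ) (K : ℕ) :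
    Pairwise (Function.onFun Disjoint (D.stopPart μ ν d K)) := by
  rintro ⟨i, j⟩ ⟨i', j'⟩ hne
  refine Set.disjoint_left.2 fun x hx hx' => hne ?_
  obtain ⟨h1, h2⟩ := hx
  obtain ⟨h1', h2'⟩ := hx'
  simp only at h1 h2 h1' h2'
  have hi : i = i' := h1.symm.trans h1'
  subst hi
  exact Prod.ext rfl (h2.symm.trans h2')

theorem iUnion_stopPart (μ : Measure X) (ν : ι → Measure X) (d : ℝ) (K : ℕ) :
    ⋃ s, D.stopPart μ ν d K s = Set.univ :=
  Set.eq_univ_of_forall fun x => Set.mem_iUnion.2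
    ⟨(D.stopLevel μ ν d K x, D.label (D.stopLevel μ ν d K x) x), rfl, rfl⟩

/-- The sharp weighted bound for the dyadic multilinear fractional maximal operator, for abstract
measures `u`, `σₖ` satisfying the `A_{P,q}` condition `hA` on the pieces of the partitions and
Hölder's inequality `hH`. -/
theorem lintegral_maxFracAvg_rpow_le [Countable J] [DecidableEq ι] [Nonempty ι] {q τ θ d : ℝ}
    {p r : ι → ℝ} {i₀ : ι} (hq : 0 < q) (hτ : 0 ≤ τ) (hpr : ∀ k, (p k).HolderConjugate (r k))
    (hsum : ∑ k, 1 / p k = 1 / q + τ)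
    (hθ : θ = r i₀ * (1 - τ)) (hθ1 : 1 ≤ θ) (hgap : ∀ k, k ≠ i₀ → r k ≤ θ)
    (hd : 0 < d) (hdι : d ≤ Fintype.card ι)
    (μ u : Measure X) (σ : ι → Measure X) (g : ι → X → ℝ≥0∞) (hg : ∀ k, Measurable (g k))
    {A : ℝ≥0∞} (hAt : A ≠ ∞)
    (hμ0 : ∀ i x, μ (D.cell i x) ≠ 0) (hμ : ∀ i x, μ (D.cell i x) ≠ ∞)
    (hu : ∀ i x, u (D.cell i x) ≠ ∞)
    (hσ0 : ∀ k i x, σ k (D.cell i x) ≠ 0) (hσ : ∀ k i x, σ k (D.cell i x) ≠ ∞)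
    (hA : ∀ i x, u (D.cell i x) * ∏ k, σ k (D.cell i x) ^ (q / r k) ≤ A * μ (D.cell i x) ^ (q * d))
    (hH : ∀ E, MeasurableSet E → μ E ^ d ≤ u E ^ (1 / q) * ∏ k, σ k E ^ (1 / r k))
    (hG : ∀ k, ∫⁻ x, g k x ^ p k ∂(σ k) < ∞) (K : ℕ) :
    ∫⁻ x, D.maxFracAvg μ (fun k => (σ k).withDensity (g k)) d K x ^ q ∂u ≤
      2 ^ (d * q) * 2 ^ (d * q * (θ - 1)) *
        (∏ k, maxAvgConst (p k) ^ pieceExponent q τ p i₀ k) * A ^ θ *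
        ∏ k, (∫⁻ x, g k x ^ p k ∂(σ k)) ^ (q / p k) := by
  set ν : ι → Measure X := fun k => (σ k).withDensity (g k) with hνdef
  have hp : ∀ k, 1 < p k := fun k => (hpr k).lt
  have hc0 : ∀ k, 0 ≤ pieceExponent q τ p i₀ k := pieceExponent_nonneg hq hpr hθ hθ1
  have hνcell : ∀ k i x, ν k (D.cell i x) = ∫⁻ y in D.cell i x, g k y ∂(σ k) := fun k i x =>
    withDensity_apply _ (D.measurableSet_cell i x)
  have hJensen : ∀ k i x, ((∫⁻ y in D.cell i x, g k y ∂(σ k)) / σ k (D.cell i x)) ^ p k *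
      σ k (D.cell i x) ≤ ∫⁻ x, g k x ^ p k ∂(σ k) := fun k i x =>
    average_rpow_mul_le (σ k) (hg k) (hσ0 k i x) (hσ k i x) (hp k)
  have hfin : ∀ k i x, ∫⁻ y in D.cell i x, g k y ∂(σ k) ≠ ∞ := fun k i x htop => by
    have h := hJensen k i x
    rw [htop, ENNReal.top_div_of_ne_top (hσ k i x),
      ENNReal.top_rpow_of_pos (by linarith [hp k]), ENNReal.top_mul (hσ0 k i x)] at h
    exact absurd (lt_of_le_of_lt h (hG k)) (lt_irrefl _)
  set E := D.stopPart μ ν d K with hE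
  have hEm : ∀ s, MeasurableSet (E s) := D.measurableSet_stopPart μ ν d K
  have hEd : Pairwise (Function.onFun Disjoint E) := D.pairwise_disjoint_stopPart μ ν d K
  let N : ι → X → ℝ≥0∞ := fun k => D.maxAvg (σ k) (g k) K
  let T : ι → ℕ × J → ℝ≥0∞ := fun k s => ∫⁻ x in E s, N k x ^ p k ∂(σ k)
  let G : ι → ℝ≥0∞ := fun k => ∫⁻ x, g k x ^ p k ∂(σ k)
  have hTsum : ∀ k, ∑' s, T k s ≤ maxAvgConst (p k) * G k := fun k => by
    calc ∑' s, T k s = ∫⁻ x in ⋃ s, E s, N k x ^ p k ∂(σ k) := (lintegral_iUnion hEm hEd _).symm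
      _ = ∫⁻ x, N k x ^ p k ∂(σ k) := by
        rw [hE, D.iUnion_stopPart, setLIntegral_univ]
      _ ≤ _ := D.lintegral_maxAvg_rpow_le (σ k) (hg k) K (hσ0 k) (hσ k) (hfin k) (hp k) (hG k)
  -- The contribution of a single stopping piece. Pieces of level `s.1` on which `s.1` is never the last
  -- stopping level have an empty `E s`.
  have hpiece : ∀ s, ∫⁻ x in E s, fracAvg μ ν d (D.cell (D.stopLevel μ ν d K x) x) ^ q ∂u ≤
      2 ^ (d * q * (θ - 1)) * A ^ θ * G i₀ ^ (q * τ) *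
        ∏ k, T k s ^ pieceExponent q τ p i₀ k := by
    rintro ⟨i, j⟩
    rcases (E (i, j)).eq_empty_or_nonempty with h | ⟨x, hx⟩
    · rw [h]; simp
    have hxi : D.stopLevel μ ν d K x = i := hx.1
    have hxj : D.label i x = j := hx.2
    have hiK : i ≤ K := hxi ▸ lastRecord_le K
    have hlevel : D.stopLevel μ ν d i x = i := by
      conv_lhs => rw [← hxi]
      rw [← hxi]; exact lastRecord_lastRecord K
    set Q := D.cell i x with hQ
    have hEQ : E (i, j) = Q ∩ {y | D.stopLevel μ ν d K y = i} := by
      ext y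
      simp only [hE, stopPart, hQ, cell, hxj, Set.mem_ofPred_eq, Set.mem_inter_iff]
      exact and_comm
    have hEsub : E (i, j) ⊆ Q := hEQ ▸ Set.inter_subset_left
    have hconst : ∫⁻ y in E (i, j), fracAvg μ ν d (D.cell (D.stopLevel μ ν d K y) y) ^ q ∂u ≤
        fracAvg μ ν d Q ^ q * u Q := by
      calc _ = ∫⁻ y in E (i, j), fracAvg μ ν d Q ^ q ∂u := by
            refine setLIntegral_congr_fun (hEm _) fun y hy => ?_
            have hy1 : D.stopLevel μ ν d K y = i := hy.1
            have hy2 : D.cell i y = Q := D.cell_eq_of_mem (hEsub hy)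
            simp only [hy1, hy2]
        _ = fracAvg μ ν d Q ^ q * u (E (i, j)) := by rw [setLIntegral_const]
        _ ≤ _ := by gcongr
    refine hconst.trans ?_
    by_cases hF : fracAvg μ ν d Q = 0
    · rw [hF, ENNReal.zero_rpow_of_pos hq, zero_mul]; exact zero_le
    have hhalf : μ Q ≤ 2 * μ (E (i, j)) := by
      rw [hEQ]
      refine D.measure_cell_le_two_mul μ ν hd hdι hμ0 hμ (fun k i x => ?_) hiK hlevel hF
      rw [hνcell]; exact hfin k i x
    have hmass := mass_le (i₀ := i₀) (A := A) hq hpr hθ hθ1 hgap hd (hu i x)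
      (fun k => hσ k i x) (hμ0 i x) (hμ i x) hAt (measure_mono hEsub) (fun k => measure_mono hEsub)
      (measure_mono hEsub) hhalf (hH _ (hEm _)) (hA i x)
    let a : ι → ℝ≥0∞ := fun k => (∫⁻ y in Q, g k y ∂(σ k)) / σ k Q
    have hνa : ∀ k, ν k Q = a k * σ k Q := fun k => by
      rw [hνcell, ENNReal.div_mul_cancel (hσ0 k i x) (hσ k i x)]
    have hvq0 : μ Q ^ (d * q) ≠ 0 := by
      simp only [ne_eq, ENNReal.rpow_eq_zero_iff, not_or, not_and]
      exact ⟨fun h => absurd h (hμ0 i x), fun h => absurd h (hμ i x)⟩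
    have haT : ∀ k, a k ^ p k * σ k (E (i, j)) ≤ T k (i, j) := fun k => by
      rw [← setLIntegral_const]
      refine setLIntegral_mono' (hEm _) fun y hy => ?_
      have hpk : 0 ≤ p k := by linarith [hp k]
      refine ENNReal.rpow_le_rpow ?_ hpk
      have hy2 : D.cell i y = Q := D.cell_eq_of_mem (hEsub hy)
      refine le_trans (le_of_eq ?_)
        (le_iSup₂ (f := fun i (_ : i ∈ Finset.range (K + 1)) =>
          (∫⁻ z in D.cell i y, g k z ∂(σ k)) / σ k (D.cell i y)) i
          (Finset.mem_range.2 (Nat.lt_succ_of_le hiK)))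
      rw [hy2]
    -- At `i₀` the exponent `q` of the average splits as `p c + p q τ`; the second part is paired with
    -- `σ_{i₀}(Q) ^ (q τ)`, to which Jensen's inequality applies.
    have hprodsplit : (∏ k, a k) ^ q * σ i₀ Q ^ (q * τ) *
          (∏ k, σ k (E (i, j)) ^ pieceExponent q τ p i₀ k) =
        (a i₀ ^ p i₀ * σ i₀ Q) ^ (q * τ) *
          ∏ k, (a k ^ p k * σ k (E (i, j))) ^ pieceExponent q τ p i₀ k := by
      have hqτ : 0 ≤ q * τ := by positivity
      have h1 : ∀ k, a k ^ q = a k ^ (p k * pieceExponent q τ p i₀ k) *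
          (if k = i₀ then a k ^ (p k * (q * τ)) else 1) := fun k => by
        have hpk : 0 < p k := by linarith [hp k]
        have hck := hc0 k
        unfold pieceExponent at hck ⊢
        split_ifs at hck ⊢ with h
        · rw [← ENNReal.rpow_add_of_nonneg _ _ (by positivity) (by positivity)]
          congr 1; field_simp; ring
        · rw [mul_one]; congr 1; field_simp; ring
      rw [← ENNReal.prod_rpow_of_nonneg hq.le, Finset.prod_congr rfl fun k _ => h1 k,
        Finset.prod_mul_distrib, Finset.prod_ite_eq', if_pos (Finset.mem_univ _),
        ENNReal.mul_rpow_of_nonneg _ _ hqτ, ← ENNReal.rpow_mul,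
        Finset.prod_congr rfl fun k _ => ENNReal.mul_rpow_of_nonneg _ _ (hc0 k),
        Finset.prod_mul_distrib, Finset.prod_congr rfl fun k _ => (ENNReal.rpow_mul _ _ _).symm]
      ring
    have hFq : fracAvg μ ν d Q ^ q * u Q =
        (∏ k, a k) ^ q * ((∏ k, σ k Q) ^ q * u Q) / μ Q ^ (d * q) := by
      unfold fracAvg
      rw [Finset.prod_congr rfl fun k _ => hνa k, Finset.prod_mul_distrib,
        ENNReal.div_rpow_of_nonneg _ _ hq.le, ENNReal.mul_rpow_of_nonneg _ _ hq.le,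
        ← ENNReal.rpow_mul]
      simp only [div_eq_mul_inv]
      ring
    rw [hFq]
    refine ENNReal.div_le_of_le_mul ?_
    calc (∏ k, a k) ^ q * ((∏ k, σ k Q) ^ q * u Q)
        ≤ (∏ k, a k) ^ q * (2 ^ (d * q * (θ - 1)) * A ^ θ * σ i₀ Q ^ (q * τ) *
          (∏ k, σ k (E (i, j)) ^ pieceExponent q τ p i₀ k) * μ Q ^ (d * q)) := by gcongr
      _ = 2 ^ (d * q * (θ - 1)) * A ^ θ * ((∏ k, a k) ^ q * σ i₀ Q ^ (q * τ) *
          (∏ k, σ k (E (i, j)) ^ pieceExponent q τ p i₀ k)) * μ Q ^ (d * q) := by ring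
      _ = 2 ^ (d * q * (θ - 1)) * A ^ θ * ((a i₀ ^ p i₀ * σ i₀ Q) ^ (q * τ) *
          ∏ k, (a k ^ p k * σ k (E (i, j))) ^ pieceExponent q τ p i₀ k) * μ Q ^ (d * q) := by
        rw [hprodsplit]
      _ ≤ 2 ^ (d * q * (θ - 1)) * A ^ θ * (G i₀ ^ (q * τ) *
          ∏ k, T k (i, j) ^ pieceExponent q τ p i₀ k) * μ Q ^ (d * q) := by
        refine mul_le_mul_left (mul_le_mul_right (mul_le_mul' ?_ ?_) _) _
        · exact ENNReal.rpow_le_rpow (hJensen i₀ i x) (by positivity)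
        · exact Finset.prod_le_prod' fun k _ => ENNReal.rpow_le_rpow (haT k) (hc0 k)
      _ = _ := by ring
  have hfinal : G i₀ ^ (q * τ) * ∏ k, G k ^ pieceExponent q τ p i₀ k = ∏ k, G k ^ (q / p k) := by
    have h1 : ∀ k, G k ^ (q / p k) = (if k = i₀ then G k ^ (q * τ) else 1) *
        G k ^ pieceExponent q τ p i₀ k := fun k => by
      have hck := hc0 k
      unfold pieceExponent at hck ⊢
      split_ifs at hck ⊢ with h
      · rw [← ENNReal.rpow_add_of_nonneg _ _ (by positivity) hck]
        congr 1; ring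
      · simp
    rw [Finset.prod_congr rfl fun k _ => h1 k, Finset.prod_mul_distrib, Finset.prod_ite_eq',
      if_pos (Finset.mem_univ _)]
  calc ∫⁻ x, D.maxFracAvg μ ν d K x ^ q ∂u
      ≤ ∫⁻ x, (2 ^ (d * q)) * fracAvg μ ν d (D.cell (D.stopLevel μ ν d K x) x) ^ q ∂u := by
        refine lintegral_mono fun x => ?_
        refine (ENNReal.rpow_le_rpow (D.maxFracAvg_le_stopLevel μ ν hd K x) hq.le).trans (le_of_eq ?_)
        rw [ENNReal.mul_rpow_of_nonneg _ _ hq.le, ← ENNReal.rpow_mul]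
    _ = 2 ^ (d * q) * ∫⁻ x, fracAvg μ ν d (D.cell (D.stopLevel μ ν d K x) x) ^ q ∂u :=
        lintegral_const_mul' _ _ (ENNReal.rpow_ne_top_of_nonneg (by positivity) (by simp))
    _ = 2 ^ (d * q) * ∑' s, ∫⁻ x in E s,
          fracAvg μ ν d (D.cell (D.stopLevel μ ν d K x) x) ^ q ∂u := by
        rw [← lintegral_iUnion hEm hEd, hE, D.iUnion_stopPart, setLIntegral_univ]
    _ ≤ 2 ^ (d * q) * ∑' s, 2 ^ (d * q * (θ - 1)) * A ^ θ * G i₀ ^ (q * τ) *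
          ∏ k, T k s ^ pieceExponent q τ p i₀ k := by
        gcongr with s
        exact hpiece s
    _ = 2 ^ (d * q) * (2 ^ (d * q * (θ - 1)) * A ^ θ * G i₀ ^ (q * τ) *
          ∑' s, ∏ k, T k s ^ pieceExponent q τ p i₀ k) := by rw [ENNReal.tsum_mul_left]
    _ ≤ 2 ^ (d * q) * (2 ^ (d * q * (θ - 1)) * A ^ θ * G i₀ ^ (q * τ) *
          ∏ k, (maxAvgConst (p k) * G k) ^ pieceExponent q τ p i₀ k) := by
        refine mul_le_mul_right (mul_le_mul_right ?_ _) _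
        refine (tsum_prod_rpow_le T _ (sum_pieceExponent hq hsum) hc0).trans ?_
        exact Finset.prod_le_prod' fun k _ => ENNReal.rpow_le_rpow (hTsum k) (hc0 k)
    _ = 2 ^ (d * q) * 2 ^ (d * q * (θ - 1)) *
        (∏ k, maxAvgConst (p k) ^ pieceExponent q τ p i₀ k) * A ^ θ *
        (G i₀ ^ (q * τ) * ∏ k, G k ^ pieceExponent q τ p i₀ k) := by
        rw [Finset.prod_congr rfl fun k _ => ENNReal.mul_rpow_of_nonneg _ _ (hc0 k),
          Finset.prod_mul_distrib]
        ring
    _ = _ := by rw [hfinal]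

end NestedPartition

/-! ### From cubes to translated dyadic grids -/

section Geometry

variable {n : ℕ}

theorem measurableSet_cube (a : Fin n → ℝ) (l : ℝ) : MeasurableSet (cube a l) :=
  MeasurableSet.univ_pi fun _ => measurableSet_Ioo

theorem isOpen_cube (a : Fin n → ℝ) (l : ℝ) : IsOpen (cube a l) :=
  isOpen_set_pi Set.finite_univ fun _ _ => isOpen_Ioo

theorem volume_cube (a : Fin n → ℝ) (l : ℝ) : volume (cube a l) = ENNReal.ofReal l ^ n := by
  rw [cube, Real.volume_pi_Ioo]
  simp

theorem volume_cube_ne_zero (a : Fin n → ℝ) {l : ℝ} (hl : 0 < l) : volume (cube a l) ≠ 0 := by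
  rw [volume_cube]
  exact pow_ne_zero _ (by simpa using hl)

theorem volume_cube_ne_top (a : Fin n → ℝ) (l : ℝ) : volume (cube a l) ≠ ∞ := by
  rw [volume_cube]
  exact ENNReal.pow_ne_top ENNReal.ofReal_ne_top

theorem floor_eq_of_floor_two_mul_eq {y z : ℝ} (h : ⌊2 * y⌋ = ⌊2 * z⌋) : ⌊y⌋ = ⌊z⌋ := by
  have key : ∀ y : ℝ, ⌊y⌋ = ⌊2 * y⌋ / 2 := fun y => by
    have := Int.floor_div_natCast (2 * y) 2
    simpa using this
  rw [key y, key z, h]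

/-- The half-open dyadic cubes of side lengths `T / 2 ^ i`, translated by `c`. -/
noncomputable def dyadicPartition (c : Fin n → ℝ) (T : ℝ) :
    NestedPartition (Fin n → ℝ) (Fin n → ℤ) where
  label i x k := ⌊(x k - c k) * (2 ^ i / T)⌋
  measurableSet_fiber i j := by
    have hm : Measurable fun (x : Fin n → ℝ) (k : Fin n) => ⌊(x k - c k) * (2 ^ i / T)⌋ :=
      measurable_pi_lambda _ fun k =>
        (((measurable_pi_apply k).sub_const _).mul_const _).floor
    exact hm (measurableSet_singleton j)
  nested i x y h := by
    funext k
    have hk := congrFun h k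
    refine floor_eq_of_floor_two_mul_eq ?_
    have e : ∀ z : ℝ, 2 * (z * (2 ^ i / T)) = z * (2 ^ (i + 1) / T) := fun z => by ring
    simpa only [e] using hk

theorem dyadic_cell_eq {c : Fin n → ℝ} {T : ℝ} (hT : 0 < T) (i : ℕ) (x : Fin n → ℝ) :
    ∃ b : Fin n → ℝ, (dyadicPartition c T).cell i x =
      Set.univ.pi fun k => Set.Ico (b k) (b k + T / 2 ^ i) := by
  refine ⟨fun k => c k + ⌊(x k - c k) * (2 ^ i / T)⌋ * (T / 2 ^ i), ?_⟩
  ext y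
  simp only [NestedPartition.cell, dyadicPartition, Set.mem_ofPred_eq, Set.mem_univ_pi, Set.mem_Ico]
  rw [funext_iff]
  refine forall_congr' fun k => ?_
  rw [Int.floor_eq_iff]
  set z : ℝ := (⌊(x k - c k) * (2 ^ i / T)⌋ : ℝ)
  have hS : (0 : ℝ) < 2 ^ i / T := by positivity
  have hST : T / 2 ^ i = (2 ^ i / T)⁻¹ := by rw [inv_div]
  rw [hST]
  have e1 : z ≤ (y k - c k) * (2 ^ i / T) ↔ c k + z * (2 ^ i / T)⁻¹ ≤ y k := by
    rw [← div_le_iff₀ hS, div_eq_mul_inv]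
    constructor <;> intro h <;> linarith
  have e2 : (y k - c k) * (2 ^ i / T) < z + 1 ↔
      y k < c k + z * (2 ^ i / T)⁻¹ + (2 ^ i / T)⁻¹ := by
    rw [← lt_div_iff₀ hS, div_eq_mul_inv, add_mul]
    constructor <;> intro h <;> linarith
  rw [e1, e2]

/-- A dyadic cell agrees up to a null set with an open cube of the same side length. -/
theorem dyadic_cell_ae_eq_cube {c : Fin n → ℝ} {T : ℝ} (hT : 0 < T) (i : ℕ) (x : Fin n → ℝ) :
    ∃ b : Fin n → ℝ, (dyadicPartition c T).cell i x =ᵐ[volume] cube b (T / 2 ^ i) := by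
  obtain ⟨b, hb⟩ := dyadic_cell_eq hT i x (c := c)
  refine ⟨b, ?_⟩
  rw [hb]
  exact (Measure.univ_pi_Ico_ae_eq_Icc (μ := fun _ : Fin n => (volume : Measure ℝ))).trans
    (Measure.univ_pi_Ioo_ae_eq_Icc (μ := fun _ : Fin n => (volume : Measure ℝ))).symm

/-- The one-third trick: the endpoints of the grids of mesh `T / 2 ^ i` based at `0` and at `T / 3`
are at distance at least `(T / 2 ^ i) / 3`, because `3` does not divide `2 ^ i`. So a shorter
interval avoids the endpoints of one of the grids. -/
theorem exists_shift_floor_eq {T : ℝ} (hT : 0 < T) (i : ℕ) {a l : ℝ} (hl : l ≤ T / 2 ^ i / 3) :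
    ∃ t : Bool, ∀ y ∈ Set.Ioo a (a + l), ∀ z ∈ Set.Ioo a (a + l),
      ⌊(y - if t then T / 3 else 0) * (2 ^ i / T)⌋ =
        ⌊(z - if t then T / 3 else 0) * (2 ^ i / T)⌋ := by
  have hS : (0 : ℝ) < 2 ^ i / T := by positivity
  have hST : T / 2 ^ i = (2 ^ i / T)⁻¹ := by rw [inv_div]
  by_contra! hcon
  have hpt : ∀ c : ℝ, (∃ y ∈ Set.Ioo a (a + l), ∃ z ∈ Set.Ioo a (a + l),
      ⌊(y - c) * (2 ^ i / T)⌋ ≠ ⌊(z - c) * (2 ^ i / T)⌋) →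
      ∃ j : ℤ, c + j * (T / 2 ^ i) ∈ Set.Ioo a (a + l) := by
    intro c
    have main : ∀ y ∈ Set.Ioo a (a + l), ∀ z ∈ Set.Ioo a (a + l),
        ⌊(y - c) * (2 ^ i / T)⌋ < ⌊(z - c) * (2 ^ i / T)⌋ →
        ∃ j : ℤ, c + j * (T / 2 ^ i) ∈ Set.Ioo a (a + l) := by
      intro y hy z hz hlt
      refine ⟨⌊(z - c) * (2 ^ i / T)⌋, ?_⟩
      have h1 := Int.floor_lt.1 hlt
      have h2 := Int.floor_le ((z - c) * (2 ^ i / T))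
      rw [← lt_div_iff₀ hS, div_eq_mul_inv, ← hST] at h1
      replace h2 := mul_le_mul_of_nonneg_right h2 (inv_pos.2 hS).le
      rw [mul_inv_cancel_right₀ hS.ne', ← hST] at h2
      exact ⟨by linarith [hy.1], by linarith [hz.2]⟩
    rintro ⟨y, hy, z, hz, hne⟩
    rcases lt_or_gt_of_ne hne with h | h
    · exact main y hy z hz h
    · exact main z hz y hy h
  obtain ⟨j₁, h₁⟩ := hpt 0 (by simpa using hcon false)
  obtain ⟨j₂, h₂⟩ := hpt (T / 3) (by simpa using hcon true)
  set S := T / 2 ^ i with hSdef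
  have hTS : T = 2 ^ i * S := by rw [hSdef]; field_simp
  have habs : |T / 3 + (j₂ - j₁) * S| < S / 3 := by
    rw [abs_lt]
    constructor <;> nlinarith [h₁.1, h₁.2, h₂.1, h₂.2]
  have hint : |((2 ^ i + 3 * (j₂ - j₁) : ℤ) : ℝ)| < 1 := by
    have e : T / 3 + (j₂ - j₁) * S = ((2 ^ i + 3 * (j₂ - j₁) : ℤ) : ℝ) * (S / 3) := by
      push_cast
      conv_lhs => rw [hTS]
      ring
    rw [e, abs_mul, abs_of_pos (by positivity : 0 < S / 3)] at habs
    exact lt_of_mul_lt_mul_right (by linarith) (by positivity : 0 ≤ S / 3)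
  have hzero : (2 ^ i + 3 * (j₂ - j₁) : ℤ) = 0 := by
    have : |(2 ^ i + 3 * (j₂ - j₁) : ℤ)| < 1 := by exact_mod_cast hint
    exact Int.abs_lt_one_iff.1 this
  have hdvd : (3 : ℤ) ∣ 2 ^ i := ⟨j₁ - j₂, by linarith⟩
  have := Int.prime_three.dvd_of_dvd_pow hdvd
  norm_num at this

/-- The translation vector with coordinates `0` and `T / 3` selected by `t`. -/
noncomputable def shift (T : ℝ) (t : Fin n → Bool) : Fin n → ℝ := fun k => if t k then T / 3 else 0

/-- Every cube of side length between `T / (3 · 2 ^ (K + 1))` and `T / 3` is contained in a cell of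
comparable size of one of `2 ^ n` translated dyadic grids. -/
theorem exists_cube_subset_cell {T : ℝ} (hT : 0 < T) (K : ℕ) {a : Fin n → ℝ} {l : ℝ}
    (hl : T / (3 * 2 ^ (K + 1)) < l) (hlT : l ≤ T / 3) {x : Fin n → ℝ} (hx : x ∈ cube a l) :
    ∃ t : Fin n → Bool, ∃ i ≤ K, cube a l ⊆ (dyadicPartition (shift T t) T).cell i x ∧
      T / 2 ^ i ≤ 6 * l := by
  classical
  have hex : ∃ i, T / (3 * 2 ^ (i + 1)) < l := ⟨K, hl⟩
  set i := Nat.find hex with hi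
  have hiK : i ≤ K := Nat.find_min' hex hl
  have hi1 : T / (3 * 2 ^ (i + 1)) < l := Nat.find_spec hex
  have hi2 : l ≤ T / 2 ^ i / 3 := by
    rcases Nat.eq_zero_or_pos i with h0 | h0
    · rw [h0]; simpa using hlT
    · have := Nat.find_min hex (m := i - 1) (by omega)
      rw [not_lt, show i - 1 + 1 = i by omega] at this
      refine this.trans (le_of_eq ?_)
      field_simp
  choose t ht using fun k => exists_shift_floor_eq hT i (a := a k) hi2
  refine ⟨t, i, hiK, fun y hy => ?_, ?_⟩
  · funext k
    exact ht k (y k) (hy k trivial) (x k) (hx k trivial)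
  · have e : T / (3 * 2 ^ (i + 1)) = T / 2 ^ i / 6 := by rw [pow_succ]; field_simp; ring
    rw [e] at hi1
    linarith

end Geometry

section Maximal

variable {n : ℕ} {ι : Type*} [Fintype ι]

/-- The multilinear fractional maximal function over the cubes with side length in `L`. -/
noncomputable def maxOn (ν : ι → Measure (Fin n → ℝ)) (d : ℝ) (L : Set ℝ) (x : Fin n → ℝ) : ℝ≥0∞ :=
  ⨆ (a : Fin n → ℝ) (l : ℝ) (_ : l ∈ L) (_ : x ∈ cube a l), fracAvg volume ν d (cube a l)

theorem measurable_maxOn (ν : ι → Measure (Fin n → ℝ)) (d : ℝ) (L : Set ℝ) :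
    Measurable (maxOn ν d L) := by
  have : LowerSemicontinuous (maxOn ν d L) := by
    refine lowerSemicontinuous_iSup fun a => lowerSemicontinuous_iSup fun l =>
      lowerSemicontinuous_iSup fun hl => ?_
    have e : (fun x => ⨆ _ : x ∈ cube a l, fracAvg volume ν d (cube a l)) =
        (cube a l).indicator fun _ => fracAvg volume ν d (cube a l) := by
      funext x
      by_cases hx : x ∈ cube a l <;> simp [hx]
    rw [e]
    exact (isOpen_cube a l).lowerSemicontinuous_indicator zero_le
  exact this.measurable

theorem maxOn_mono (ν : ι → Measure (Fin n → ℝ)) (d : ℝ) {L L' : Set ℝ} (h : L ⊆ L')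
    (x : Fin n → ℝ) : maxOn ν d L x ≤ maxOn ν d L' x := by
  refine iSup_mono fun a => iSup_mono fun l => iSup_le fun hl => ?_
  exact le_iSup_of_le (h hl) le_rfl

/-- The side lengths in the `N`-th truncation of the maximal function. -/
def sideRange (N : ℕ) : Set ℝ := Set.Ioc (3 * 2 ^ N / (3 * 2 ^ (2 * N + 1))) (3 * 2 ^ N / 3)

theorem sideRange_eq (N : ℕ) : sideRange N = Set.Ioc ((1 / 2 : ℝ) ^ (N + 1)) (2 ^ N) := by
  rw [sideRange]
  congr 1
  · rw [show 2 * N + 1 = N + (N + 1) by ring, pow_add, one_div, inv_pow]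
    field_simp
  · field_simp

theorem sideRange_mono : Monotone sideRange := by
  intro N M h
  rw [sideRange_eq, sideRange_eq]
  refine Set.Ioc_subset_Ioc ?_ ?_
  · exact pow_le_pow_of_le_one (by norm_num) (by norm_num) (by omega)
  · exact pow_le_pow_right₀ (by norm_num) h

theorem exists_mem_sideRange {l : ℝ} (hl : 0 < l) : ∃ N, l ∈ sideRange N := by
  obtain ⟨N, hN⟩ := exists_pow_lt_of_lt_one hl (by norm_num : (1 / 2 : ℝ) < 1)
  obtain ⟨M, hM⟩ := pow_unbounded_of_one_lt l (by norm_num : (1 : ℝ) < 2)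
  refine ⟨max N M, ?_⟩
  rw [sideRange_eq]
  constructor
  · exact (pow_le_pow_of_le_one (by norm_num) (by norm_num) (by omega)).trans_lt hN
  · exact hM.le.trans (pow_le_pow_right₀ (by norm_num) (le_max_right _ _))

theorem maxOn_Ioi_eq_iSup (ν : ι → Measure (Fin n → ℝ)) (d : ℝ) (x : Fin n → ℝ) :
    maxOn ν d (Set.Ioi 0) x = ⨆ N, maxOn ν d (sideRange N) x := by
  apply le_antisymm
  · refine iSup_le fun a => iSup_le fun l => iSup_le fun hl => iSup_le fun hx => ?_
    obtain ⟨N, hN⟩ := exists_mem_sideRange hl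
    exact le_iSup_of_le N (le_iSup_of_le a (le_iSup_of_le l (le_iSup_of_le hN
      (le_iSup_of_le hx le_rfl))))
  · refine iSup_le fun N => maxOn_mono ν d (fun l hl => ?_) x
    rw [sideRange_eq] at hl
    exact lt_trans (by positivity) hl.1

/-- Up to the constant `6 ^ (n d)`, the truncated maximal function is dominated by finitely many
dyadic ones. -/
theorem maxOn_sideRange_le (ν : ι → Measure (Fin n → ℝ)) {d : ℝ} (hd : 0 < d) (N : ℕ)
    (x : Fin n → ℝ) : maxOn ν d (sideRange N) x ≤ (6 ^ n) ^ d *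
      ⨆ t : Fin n → Bool, (dyadicPartition (shift (3 * 2 ^ N) t) (3 * 2 ^ N)).maxFracAvg
        volume ν d (2 * N) x := by
  refine iSup_le fun a => iSup_le fun l => iSup_le fun hl => iSup_le fun hx => ?_
  have hT : (0 : ℝ) < 3 * 2 ^ N := by positivity
  obtain ⟨t, i, hi, hsub, hle⟩ := exists_cube_subset_cell hT (2 * N) hl.1 hl.2 hx
  set D := dyadicPartition (shift (3 * 2 ^ N) t) (3 * 2 ^ N) with hD
  have hvol : volume (D.cell i x) ≤ 6 ^ n * volume (cube a l) := by
    obtain ⟨b, hb⟩ := dyadic_cell_ae_eq_cube hT i x (c := shift (3 * 2 ^ N) t)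
    rw [measure_congr hb, volume_cube, volume_cube, ← mul_pow]
    refine pow_le_pow_left' ?_ n
    rw [show (6 : ℝ≥0∞) = ENNReal.ofReal 6 by simp, ← ENNReal.ofReal_mul (by norm_num)]
    exact ENNReal.ofReal_le_ofReal hle
  have hct : ((6 : ℝ≥0∞) ^ n) ≠ ∞ := ENNReal.pow_ne_top (by simp)
  have hmain : fracAvg volume ν d (cube a l) ≤
      (6 ^ n) ^ d * fracAvg volume ν d (D.cell i x) := by
    unfold fracAvg
    calc (∏ k, ν k (cube a l)) / volume (cube a l) ^ d
        ≤ (∏ k, ν k (D.cell i x)) / (volume (D.cell i x) / 6 ^ n) ^ d := by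
          refine ENNReal.div_le_div (Finset.prod_le_prod' fun k _ => measure_mono hsub) ?_
          refine ENNReal.rpow_le_rpow ?_ hd.le
          exact ENNReal.div_le_of_le_mul' hvol
      _ = _ := by
          rw [ENNReal.div_rpow_of_nonneg _ _ hd.le, div_eq_mul_inv, div_eq_mul_inv, div_eq_mul_inv,
            ENNReal.mul_inv (Or.inr (ENNReal.inv_ne_top.2 ?_)) (Or.inr (ENNReal.inv_ne_zero.2 ?_)),
            inv_inv]
          · ring
          · simp [ENNReal.rpow_eq_zero_iff]
          · exact ENNReal.rpow_ne_top_of_nonneg hd.le hct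
  refine hmain.trans (mul_le_mul_right ?_ _)
  refine le_trans ?_ (le_iSup _ t)
  exact le_iSup₂ (f := fun i (_ : i ∈ Finset.range (2 * N + 1)) =>
    fracAvg volume ν d (D.cell i x)) i (Finset.mem_range.2 (Nat.lt_succ_of_le hi))

/-- The sharp weighted bound for the multilinear fractional maximal operator, for measures `u`, `σₖ`
on `ℝⁿ` satisfying the `A_{P,q}` condition `hA` on cubes and Hölder's inequality `hH`. -/
theorem lintegral_maxOn_rpow_le [DecidableEq ι] [Nonempty ι] {q τ θ d : ℝ}
    {p r : ι → ℝ} {i₀ : ι} (hq : 0 < q) (hτ : 0 ≤ τ) (hpr : ∀ k, (p k).HolderConjugate (r k))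
    (hsum : ∑ k, 1 / p k = 1 / q + τ)
    (hθ : θ = r i₀ * (1 - τ)) (hθ1 : 1 ≤ θ) (hgap : ∀ k, k ≠ i₀ → r k ≤ θ)
    (hd : 0 < d) (hdι : d ≤ Fintype.card ι)
    (u : Measure (Fin n → ℝ)) (σ : ι → Measure (Fin n → ℝ)) (g : ι → (Fin n → ℝ) → ℝ≥0∞)
    (hg : ∀ k, Measurable (g k)) {A : ℝ≥0∞} (hAt : A ≠ ∞)
    (huac : u ≪ volume) (hσac : ∀ k, σ k ≪ volume)
    (hu : ∀ a l, 0 < l → u (cube a l) ≠ ∞)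
    (hσ0 : ∀ k a l, 0 < l → σ k (cube a l) ≠ 0) (hσ : ∀ k a l, 0 < l → σ k (cube a l) ≠ ∞)
    (hA : ∀ a l, 0 < l → u (cube a l) * ∏ k, σ k (cube a l) ^ (q / r k) ≤
      A * volume (cube a l) ^ (q * d))
    (hH : ∀ E, MeasurableSet E → volume E ^ d ≤ u E ^ (1 / q) * ∏ k, σ k E ^ (1 / r k))
    (hG : ∀ k, ∫⁻ x, g k x ^ p k ∂(σ k) < ∞) :
    ∫⁻ x, maxOn (fun k => (σ k).withDensity (g k)) d (Set.Ioi 0) x ^ q ∂u ≤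
      ((6 ^ n) ^ d) ^ q * (2 ^ n * (2 ^ (d * q) * 2 ^ (d * q * (θ - 1)) *
        (∏ k, maxAvgConst (p k) ^ pieceExponent q τ p i₀ k) * A ^ θ *
        ∏ k, (∫⁻ x, g k x ^ p k ∂(σ k)) ^ (q / p k))) := by
  set ν : ι → Measure (Fin n → ℝ) := fun k => (σ k).withDensity (g k)
  set R := 2 ^ (d * q) * 2 ^ (d * q * (θ - 1)) *
        (∏ k, maxAvgConst (p k) ^ pieceExponent q τ p i₀ k) * A ^ θ *
        ∏ k, (∫⁻ x, g k x ^ p k ∂(σ k)) ^ (q / p k) with hR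
  have hsup : ∀ x, maxOn ν d (Set.Ioi 0) x ^ q = ⨆ N, maxOn ν d (sideRange N) x ^ q := fun x => by
    rw [maxOn_Ioi_eq_iSup]
    exact (ENNReal.orderIsoRpow q hq).map_iSup _
  simp_rw [hsup]
  rw [lintegral_iSup (fun N => (measurable_maxOn ν d _).pow_const q)
    (fun N M h x => ENNReal.rpow_le_rpow (maxOn_mono ν d (sideRange_mono h) x) hq.le)]
  refine iSup_le fun N => ?_
  have hT : (0 : ℝ) < 3 * 2 ^ N := by positivity
  set D : (Fin n → Bool) → NestedPartition (Fin n → ℝ) (Fin n → ℤ) := fun t =>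
    dyadicPartition (shift (3 * 2 ^ N) t) (3 * 2 ^ N) with hD
  have hdy : ∀ t, ∫⁻ x, (D t).maxFracAvg volume ν d (2 * N) x ^ q ∂u ≤ R := by
    intro t
    have hS : ∀ i : ℕ, (0 : ℝ) < 3 * 2 ^ N / 2 ^ i := fun i => by positivity
    choose b hb using fun i x => dyadic_cell_ae_eq_cube hT i x (c := shift (3 * 2 ^ N) t)
    have hbu : ∀ i x, u ((D t).cell i x) = u (cube (b i x) (3 * 2 ^ N / 2 ^ i)) := fun i x =>
      measure_congr (huac.ae_eq (hb i x))
    have hbσ : ∀ k i x, σ k ((D t).cell i x) = σ k (cube (b i x) (3 * 2 ^ N / 2 ^ i)) :=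
      fun k i x => measure_congr ((hσac k).ae_eq (hb i x))
    have hbv : ∀ i x, volume ((D t).cell i x) = volume (cube (b i x) (3 * 2 ^ N / 2 ^ i)) :=
      fun i x => measure_congr (hb i x)
    refine (D t).lintegral_maxFracAvg_rpow_le hq hτ hpr hsum hθ hθ1 hgap hd hdι volume u σ g hg hAt
      ?_ ?_ ?_ ?_ ?_ ?_ hH hG (2 * N)
    · intro i x; rw [hbv]; exact volume_cube_ne_zero _ (hS i)
    · intro i x; rw [hbv]; exact volume_cube_ne_top _ _
    · intro i x; rw [hbu]; exact hu _ _ (hS i)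
    · intro k i x; rw [hbσ]; exact hσ0 k _ _ (hS i)
    · intro k i x; rw [hbσ]; exact hσ k _ _ (hS i)
    · intro i x
      simp only [hbu, hbσ, hbv]
      exact hA _ _ (hS i)
  have hmeas : ∀ t, Measurable fun x => (D t).maxFracAvg volume ν d (2 * N) x ^ q := fun t => by
    refine Measurable.pow_const ?_ q
    refine Measurable.biSup _ (Set.to_countable _) fun i _ => ?_
    exact (D t).measurable_of_label (i := i) fun x y h => by rw [(D t).cell_congr h]
  calc ∫⁻ x, maxOn ν d (sideRange N) x ^ q ∂u
      ≤ ∫⁻ x, ((6 ^ n) ^ d) ^ q * ∑ t, (D t).maxFracAvg volume ν d (2 * N) x ^ q ∂u := by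
        refine lintegral_mono fun x => ?_
        refine (ENNReal.rpow_le_rpow (maxOn_sideRange_le ν hd N x) hq.le).trans ?_
        rw [ENNReal.mul_rpow_of_nonneg _ _ hq.le]
        refine mul_le_mul_right ?_ _
        have hsup' : (⨆ t, (D t).maxFracAvg volume ν d (2 * N) x) ^ q =
            ⨆ t, (D t).maxFracAvg volume ν d (2 * N) x ^ q :=
          (ENNReal.orderIsoRpow q hq).map_iSup _
        rw [hsup']
        exact iSup_le fun t => Finset.single_le_sum
          (f := fun t => (D t).maxFracAvg volume ν d (2 * N) x ^ q)
          (fun _ _ => zero_le) (Finset.mem_univ t)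
    _ = ((6 ^ n) ^ d) ^ q * ∑ t, ∫⁻ x, (D t).maxFracAvg volume ν d (2 * N) x ^ q ∂u := by
        rw [lintegral_const_mul _ (Finset.measurable_sum _ fun t _ => hmeas t),
          lintegral_finsetSum _ fun t _ => hmeas t]
    _ ≤ ((6 ^ n) ^ d) ^ q * (2 ^ n * R) := by
        refine mul_le_mul_right ?_ _
        refine (Finset.sum_le_sum fun t _ => hdy t).trans (le_of_eq ?_)
        simp

end Maximal

/-! ### The weighted bound for multiple weights -/

section Weights

variable {m n : ℕ}

theorem cube_subset_centered (a : Fin n → ℝ) (l : ℝ) :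
    ∃ N : ℕ, cube a l ⊆ cube (fun _ => -(N : ℝ)) (2 * N) := by
  obtain ⟨N, hN⟩ := exists_nat_ge (‖a‖ + |l|)
  refine ⟨N, fun x hx k hk => ?_⟩
  have h1 := hx k hk
  have h2 := (Real.norm_eq_abs _).symm.trans_le (norm_le_pi_norm a k)
  have h3 := abs_le.1 h2
  have h4 := le_abs_self l
  have h5 := abs_nonneg l
  have h6 := norm_nonneg a
  constructor <;> linarith [h1.1, h1.2, h3.1, h3.2]

theorem centered_mono {N M : ℕ} (h : N ≤ M) :
    cube (n := n) (fun _ => -(N : ℝ)) (2 * N) ⊆ cube (fun _ => -(M : ℝ)) (2 * M) := by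
  have h' : (N : ℝ) ≤ M := by exact_mod_cast h
  refine fun x hx k hk => ?_
  have h1 := hx k hk
  constructor <;> linarith [h1.1, h1.2]

theorem iUnion_centered : ⋃ N : ℕ, cube (n := n) (fun _ => -(N : ℝ)) (2 * N) = Set.univ := by
  refine Set.eq_univ_of_forall fun x => Set.mem_iUnion.2 ?_
  obtain ⟨N, hN⟩ := cube_subset_centered (fun k => x k - 1) 2
  exact ⟨N, hN fun k _ => ⟨by linarith, by linarith⟩⟩

theorem aemeasurable_wpow {w : (Fin n → ℝ) → ℝ} (hw : IsWeight w) (s : ℝ) :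
    AEMeasurable (wpow w s) volume :=
  hw.locallyIntegrable.aestronglyMeasurable.aemeasurable.ennreal_ofReal.pow_const s

theorem aemeasurable_uWeight (q : ℝ) {w : Fin m → (Fin n → ℝ) → ℝ} (hw : ∀ i, IsWeight (w i)) :
    AEMeasurable (uWeight q w) volume := by
  unfold uWeight wpow
  refine (AEMeasurable.ennreal_ofReal ?_).pow_const q
  exact Finset.aemeasurable_fun_prod _ fun i _ =>
    (hw i).locallyIntegrable.aestronglyMeasurable.aemeasurable

theorem sigmaWeight_ne_zero {p : Fin m → ℝ} (hp : ∀ i, 1 < p i) (w : Fin m → (Fin n → ℝ) → ℝ)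
    (i : Fin m) (x : Fin n → ℝ) : sigmaWeight p w i x ≠ 0 := by
  have hr := (Real.HolderConjugate.conjExponent (hp i)).symm.pos
  simp only [sigmaWeight, wpow, ne_eq, ENNReal.rpow_eq_zero_iff, not_or, not_and]
  exact ⟨fun _ => by linarith, fun h => absurd h ENNReal.ofReal_ne_top⟩

theorem withDensity_cube (g : (Fin n → ℝ) → ℝ≥0∞) (a : Fin n → ℝ) (l : ℝ) :
    volume.withDensity g (cube a l) = ∫⁻ y in cube a l, g y :=
  withDensity_apply _ (measurableSet_cube a l)

theorem withDensity_sigmaWeight_cube_ne_zero {p : Fin m → ℝ} (hp : ∀ i, 1 < p i)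
    {w : Fin m → (Fin n → ℝ) → ℝ} (hw : ∀ i, IsWeight (w i)) (i : Fin m) (a : Fin n → ℝ) {l : ℝ}
    (hl : 0 < l) : volume.withDensity (sigmaWeight p w i) (cube a l) ≠ 0 := by
  have hS : AEMeasurable (sigmaWeight p w i) volume := aemeasurable_wpow (hw i) _
  rw [Ne, withDensity_apply_eq_zero' hS]
  have : {x | sigmaWeight p w i x ≠ 0} = Set.univ :=
    Set.eq_univ_of_forall fun x => sigmaWeight_ne_zero hp w i x
  rw [this, Set.univ_inter]
  exact volume_cube_ne_zero a hl

theorem cubeAvg_eq (g : (Fin n → ℝ) → ℝ≥0∞) (a : Fin n → ℝ) (l : ℝ) :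
    cubeAvg g a l = volume.withDensity g (cube a l) / volume (cube a l) := by
  rw [cubeAvg, withDensity_cube]

theorem cubeAvg_mul_prod_le (p : Fin m → ℝ) (q : ℝ) (w : Fin m → (Fin n → ℝ) → ℝ) (a : Fin n → ℝ)
    {l : ℝ} (hl : 0 < l) : cubeAvg (uWeight q w) a l *
      ∏ i, cubeAvg (sigmaWeight p w i) a l ^ (q / (p i).conjExponent) ≤ apqConst p q w :=
  le_iSup_of_le a (le_iSup_of_le l (le_iSup_of_le hl le_rfl))

theorem rpow_ne_zero_of_pos {x : ℝ≥0∞} (hx : x ≠ 0) {s : ℝ} (hs : 0 < s) : x ^ s ≠ 0 := by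
  simp only [ne_eq, ENNReal.rpow_eq_zero_iff, not_or, not_and]
  exact ⟨fun h => absurd h hx, fun _ => by linarith⟩

variable {q : ℝ} {p : Fin m → ℝ} {w : Fin m → (Fin n → ℝ) → ℝ}

/-- On a cube charged by `u_w`, the `A_{P,q}` condition forces the mass of every `σᵢ` to be finite. -/
theorem withDensity_sigmaWeight_ne_top_of_charged (hq : 0 < q) (hp : ∀ i, 1 < p i)
    (hw : MemApq p q w) {a : Fin n → ℝ} {l : ℝ} (hl : 0 < l)
    (hu : volume.withDensity (uWeight q w) (cube a l) ≠ 0) (i : Fin m) :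
    volume.withDensity (sigmaWeight p w i) (cube a l) ≠ ∞ := by
  intro htop
  have hr : ∀ j, 0 < q / (p j).conjExponent := fun j =>
    div_pos hq (Real.HolderConjugate.conjExponent (hp j)).symm.pos
  have hle := (cubeAvg_mul_prod_le p q w a hl).trans_lt hw.const_lt_top
  have hu' : cubeAvg (uWeight q w) a l ≠ 0 := by
    rw [cubeAvg_eq]; exact ENNReal.div_ne_zero.2 ⟨hu, volume_cube_ne_top a l⟩
  have hs' : ∀ j, cubeAvg (sigmaWeight p w j) a l ≠ 0 := fun j => by
    rw [cubeAvg_eq]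
    exact ENNReal.div_ne_zero.2 ⟨withDensity_sigmaWeight_cube_ne_zero hp hw.isWeight j a hl,
      volume_cube_ne_top a l⟩
  have hi : cubeAvg (sigmaWeight p w i) a l ^ (q / (p i).conjExponent) = ∞ := by
    rw [cubeAvg_eq, htop, ENNReal.top_div_of_ne_top (volume_cube_ne_top a l),
      ENNReal.top_rpow_of_pos (hr i)]
  rw [← Finset.mul_prod_erase _ _ (Finset.mem_univ i), hi, ENNReal.top_mul, ENNReal.mul_top hu']
    at hle
  · exact lt_irrefl _ hle
  · exact Finset.prod_ne_zero_iff.2 fun j _ => rpow_ne_zero_of_pos (hs' j) (hr j)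

theorem withDensity_sigmaWeight_cube_ne_top (hq : 0 < q) (hp : ∀ i, 1 < p i)
    (hw : MemApq p q w) (hu : targetMeasure q w ≠ 0) (i : Fin m) (a : Fin n → ℝ) (l : ℝ) :
    volume.withDensity (sigmaWeight p w i) (cube a l) ≠ ∞ := by
  obtain ⟨N₁, hN₁⟩ : ∃ N : ℕ, targetMeasure q w (cube (fun _ => -(N : ℝ)) (2 * N)) ≠ 0 := by
    by_contra! h
    refine hu (Measure.measure_univ_eq_zero.1 ?_)
    rw [← iUnion_centered]
    exact measure_iUnion_null h
  obtain ⟨N₂, hN₂⟩ := cube_subset_centered a l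
  set N := max (max N₁ N₂) 1 with hN
  have hN0 : (0 : ℝ) < 2 * N := by
    have : 1 ≤ N := le_max_right _ _
    have : (1 : ℝ) ≤ N := by exact_mod_cast this
    linarith
  refine ne_top_of_le_ne_top (withDensity_sigmaWeight_ne_top_of_charged hq hp hw
    (a := fun _ => -(N : ℝ)) hN0 (fun h => hN₁ ?_) i)
    (measure_mono (hN₂.trans (centered_mono (by omega))))
  exact le_zero_iff.1 ((measure_mono (centered_mono (by omega))).trans h.le)

theorem targetMeasure_cube_ne_top (hq : 0 < q) (hp : ∀ i, 1 < p i)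
    (hw : MemApq p q w) (a : Fin n → ℝ) {l : ℝ} (hl : 0 < l) :
    targetMeasure q w (cube a l) ≠ ∞ := by
  intro htop
  have hr : ∀ j, 0 < q / (p j).conjExponent := fun j =>
    div_pos hq (Real.HolderConjugate.conjExponent (hp j)).symm.pos
  have hle := (cubeAvg_mul_prod_le p q w a hl).trans_lt hw.const_lt_top
  have hs' : ∀ j, cubeAvg (sigmaWeight p w j) a l ≠ 0 := fun j => by
    rw [cubeAvg_eq]
    exact ENNReal.div_ne_zero.2 ⟨withDensity_sigmaWeight_cube_ne_zero hp hw.isWeight j a hl,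
      volume_cube_ne_top a l⟩
  rw [targetMeasure] at htop
  rw [cubeAvg_eq, htop, ENNReal.top_div_of_ne_top (volume_cube_ne_top a l), ENNReal.top_mul] at hle
  · exact lt_irrefl _ hle
  · exact Finset.prod_ne_zero_iff.2 fun j _ => rpow_ne_zero_of_pos (hs' j) (hr j)

/-- A weight vanishing on a set of positive measure would make `σᵢ` infinite there. -/
theorem ae_pos_of_memApq (hq : 0 < q) (hp : ∀ i, 1 < p i)
    (hw : MemApq p q w) (hu : targetMeasure q w ≠ 0) (i : Fin m) : ∀ᵐ x, 0 < w i x := by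
  have hS : AEMeasurable (sigmaWeight p w i) volume := aemeasurable_wpow (hw.isWeight i) _
  have h1 : ∀ᵐ x ∂(volume.restrict (⋃ N : ℕ, cube (n := n) (fun _ => -(N : ℝ)) (2 * N))),
      sigmaWeight p w i x < ∞ := by
    rw [ae_restrict_iUnion_iff]
    intro N
    refine ae_lt_top' hS.restrict ?_
    rw [← withDensity_cube]
    exact withDensity_sigmaWeight_cube_ne_top hq hp hw hu i _ _
  rw [iUnion_centered, Measure.restrict_univ] at h1
  filter_upwards [h1] with x hx
  refine lt_of_le_of_ne ((hw.isWeight i).nonneg x) fun h0 => ?_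
  have hr := (Real.HolderConjugate.conjExponent (hp i)).symm.pos
  rw [sigmaWeight, wpow, ← h0, ENNReal.ofReal_zero, ENNReal.zero_rpow_of_neg (by linarith)] at hx
  exact lt_irrefl _ hx

/-- Hölder's inequality, from `u_w ^ (1/q) ∏ σᵢ ^ (1/pᵢ') = 1`. -/
theorem volume_rpow_le (hq : 0 < q) (hp : ∀ i, 1 < p i) {τ : ℝ}
    (hsum : ∑ i, 1 / p i = 1 / q + τ) (hd : 0 < (m : ℝ) - τ)
    (hw : ∀ i, IsWeight (w i)) (hpos : ∀ i, ∀ᵐ x, 0 < w i x) (E : Set (Fin n → ℝ))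
    (hE : MeasurableSet E) :
    volume E ^ ((m : ℝ) - τ) ≤ targetMeasure q w E ^ (1 / q) *
      ∏ i, volume.withDensity (sigmaWeight p w i) E ^ (1 / (p i).conjExponent) := by
  set d := (m : ℝ) - τ with hddef
  have hpr : ∀ i, (p i).HolderConjugate (p i).conjExponent := fun i =>
    Real.HolderConjugate.conjExponent (hp i)
  have hr : ∀ i, 0 < (p i).conjExponent := fun i => (hpr i).symm.pos
  have hsumd : 1 / q + ∑ i, 1 / (p i).conjExponent = d := by
    rw [Finset.sum_congr rfl fun i _ => one_div_conj (hpr i), Finset.sum_sub_distrib, hsum]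
    simp [hddef]; ring
  let F : Option (Fin m) → (Fin n → ℝ) → ℝ≥0∞ := fun o => o.elim (uWeight q w) (sigmaWeight p w)
  let c : Option (Fin m) → ℝ := fun o => o.elim (1 / q / d) fun i => 1 / (p i).conjExponent / d
  have hF : ∀ o ∈ Finset.univ, AEMeasurable (F o) (volume.restrict E) := by
    rintro (_ | i) -
    · exact (aemeasurable_uWeight q hw).restrict
    · exact (aemeasurable_wpow (hw i) _).restrict
  have hc : ∑ o, c o = 1 := by
    rw [Fintype.sum_option]
    simp only [c, Option.elim]
    rw [← Finset.sum_div, ← add_div, hsumd, div_self hd.ne']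
  have hc0 : ∀ o ∈ Finset.univ, 0 ≤ c o := by
    rintro (_ | i) -
    · simp only [c, Option.elim]; positivity
    · have := hr i
      simp only [c, Option.elim]; positivity
  have hH := ENNReal.lintegral_prod_norm_pow_le Finset.univ hF hc hc0
  have hone : ∫⁻ x in E, ∏ o, F o x ^ c o = volume E := by
    rw [← setLIntegral_one]
    refine lintegral_congr_ae (ae_restrict_of_ae ?_)
    filter_upwards [ae_all_iff.2 hpos] with x hx
    rw [Fintype.prod_option]
    simp only [F, c, Option.elim, uWeight, sigmaWeight, wpow]
    have e1 : (ENNReal.ofReal (∏ i, w i x) ^ q) ^ (1 / q / d) =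
        (∏ i, ENNReal.ofReal (w i x)) ^ (1 / d) := by
      rw [ENNReal.ofReal_prod_of_nonneg fun i _ => (hx i).le, ← ENNReal.rpow_mul]
      congr 1; field_simp
    have e2 : ∀ i, (ENNReal.ofReal (w i x) ^ (-(p i).conjExponent)) ^
        (1 / (p i).conjExponent / d) = ENNReal.ofReal (w i x) ^ (-(1 / d)) := fun i => by
      rw [← ENNReal.rpow_mul]
      have := (hr i).ne'
      congr 1; field_simp
    rw [e1, Finset.prod_congr rfl fun i _ => e2 i, ← ENNReal.prod_rpow_of_nonneg (by positivity),
      ← Finset.prod_mul_distrib]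
    refine Finset.prod_eq_one fun i _ => ?_
    rw [← ENNReal.rpow_add _ _ (by simpa using hx i) ENNReal.ofReal_ne_top]
    simp
  rw [hone, Fintype.prod_option] at hH
  simp only [F, c, Option.elim] at hH
  have hfin := ENNReal.rpow_le_rpow hH hd.le
  rw [ENNReal.mul_rpow_of_nonneg _ _ hd.le, ← ENNReal.prod_rpow_of_nonneg hd.le,
    ← ENNReal.rpow_mul, div_mul_cancel₀ _ hd.ne'] at hfin
  refine hfin.trans (le_of_eq ?_)
  rw [targetMeasure, withDensity_apply _ hE]
  congr 1
  refine Finset.prod_congr rfl fun i _ => ?_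
  rw [← ENNReal.rpow_mul, div_mul_cancel₀ _ hd.ne', withDensity_apply _ hE]

/-- The `A_{P,q}` condition on a cube, in terms of masses instead of averages. -/
theorem apq_mass_le (hq : 0 < q) (hp : ∀ i, 1 < p i) {τ : ℝ}
    (hsum : ∑ i, 1 / p i = 1 / q + τ) (a : Fin n → ℝ) {l : ℝ} (hl : 0 < l) :
    targetMeasure q w (cube a l) *
        ∏ i, volume.withDensity (sigmaWeight p w i) (cube a l) ^ (q / (p i).conjExponent) ≤
      apqConst p q w * volume (cube a l) ^ (q * ((m : ℝ) - τ)) := by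
  set V := volume (cube a l)
  have hV0 : V ≠ 0 := volume_cube_ne_zero a hl
  have hVt : V ≠ ∞ := volume_cube_ne_top a l
  have hpr : ∀ i, (p i).HolderConjugate (p i).conjExponent := fun i =>
    Real.HolderConjugate.conjExponent (hp i)
  have hr : ∀ i, 0 < q / (p i).conjExponent := fun i => div_pos hq (hpr i).symm.pos
  have hexp : 1 + ∑ i, q / (p i).conjExponent = q * ((m : ℝ) - τ) := by
    have : ∀ i, q / (p i).conjExponent = q * (1 - 1 / p i) := fun i => by
      rw [← one_div_conj (hpr i)]; ring
    rw [Finset.sum_congr rfl fun i _ => this i, ← Finset.mul_sum, Finset.sum_sub_distrib, hsum]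
    simp only [Finset.sum_const, Finset.card_univ, Fintype.card_fin, nsmul_eq_mul, mul_one]
    field_simp
    ring
  have hVprod : V ^ (q * ((m : ℝ) - τ)) = V * ∏ i, V ^ (q / (p i).conjExponent) := by
    have : ∏ i, V ^ (q / (p i).conjExponent) = V ^ ∑ i, q / (p i).conjExponent := by
      induction (Finset.univ : Finset (Fin m)) using Finset.induction with
      | empty => simp
      | insert i s hi ih => rw [Finset.prod_insert hi, Finset.sum_insert hi, ih,
          ENNReal.rpow_add _ _ hV0 hVt]
    rw [this, ← hexp, ENNReal.rpow_add _ _ hV0 hVt, ENNReal.rpow_one]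
  have hsplit : ∀ (g : (Fin n → ℝ) → ℝ≥0∞),
      volume.withDensity g (cube a l) = cubeAvg g a l * V := fun g => by
    rw [cubeAvg_eq, ENNReal.div_mul_cancel hV0 hVt]
  rw [targetMeasure, hsplit, Finset.prod_congr rfl fun i _ => by
    rw [hsplit, ENNReal.mul_rpow_of_nonneg _ _ (hr i).le], Finset.prod_mul_distrib, hVprod]
  calc _ = cubeAvg (uWeight q w) a l *
      (∏ i, cubeAvg (sigmaWeight p w i) a l ^ (q / (p i).conjExponent)) *
        (V * ∏ i, V ^ (q / (p i).conjExponent)) := by ring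
    _ ≤ _ := mul_le_mul_left (cubeAvg_mul_prod_le p q w a hl) _

theorem maximalFn_eq_maxOn {α : ℝ} (hm : 0 < m) (hn : 0 < n) (f : Fin m → (Fin n → ℝ) → ℂ)
    (x : Fin n → ℝ) : maximalFn α f x =
      maxOn (fun i => volume.withDensity fun y => ‖f i y‖ₑ) ((m : ℝ) - α / n) (Set.Ioi 0) x := by
  unfold maximalFn maxOn fracAvg
  refine iSup_congr fun a => iSup_congr fun l => iSup_congr fun hl => iSup_congr fun hx => ?_
  simp only [div_eq_mul_inv, Finset.prod_mul_distrib, withDensity_cube, Finset.prod_const,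
    Finset.card_univ, Fintype.card_fin]
  congr 1
  rw [← ENNReal.inv_pow, ← ENNReal.rpow_natCast, ← ENNReal.rpow_mul]
  congr 2
  have : (m : ℝ) ≠ 0 := by exact_mod_cast hm.ne'
  have : (n : ℝ) ≠ 0 := by exact_mod_cast hn.ne'
  field_simp

theorem measurable_maximalFn {α : ℝ} (hm : 0 < m) (hn : 0 < n) (f : Fin m → (Fin n → ℝ) → ℂ) :
    Measurable (maximalFn α f) := by
  have : maximalFn α f = maxOn (fun i => volume.withDensity fun y => ‖f i y‖ₑ)
      ((m : ℝ) - α / n) (Set.Ioi 0) := funext (maximalFn_eq_maxOn hm hn f)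
  rw [this]
  exact measurable_maxOn _ _ _

/-- The change of unknown `fᵢ = gᵢ σᵢ`, which turns `L^{pᵢ}(wᵢ^{pᵢ})` into `L^{pᵢ}(σᵢ)`. -/
theorem exists_density_eq (hp : ∀ i, 1 < p i) (hw : ∀ i, IsWeight (w i))
    (hpos : ∀ i, ∀ᵐ x, 0 < w i x) {f : Fin m → (Fin n → ℝ) → ℂ} (hf : MemSource p w f)
    (i : Fin m) : ∃ g : (Fin n → ℝ) → ℝ≥0∞, Measurable g ∧
      (volume.withDensity (sigmaWeight p w i)).withDensity g =
        volume.withDensity (fun y => ‖f i y‖ₑ) ∧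
      ∫⁻ x, g x ^ p i ∂(volume.withDensity (sigmaWeight p w i)) =
        eLpNorm (f i) (ENNReal.ofReal (p i)) (sourceMeasure p w i) ^ p i := by
  have hp0 : 0 < p i := by linarith [hp i]
  have hp1 : 0 < p i - 1 := by linarith [hp i]
  have hS : AEMeasurable (sigmaWeight p w i) volume := aemeasurable_wpow (hw i) _
  have hW : AEMeasurable (wpow (w i) (p i)) volume := aemeasurable_wpow (hw i) _
  have hfm : AEStronglyMeasurable (f i) volume := by
    refine (hf i).1.mono_ac (withDensity_absolutelyContinuous' hW ?_)
    filter_upwards [hpos i] with x hx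
    exact rpow_ne_zero_of_pos (by simpa using hx) hp0
  have hh : AEMeasurable (fun y => ‖f i y‖ₑ) volume := hfm.enorm
  set h := hh.mk _ with hhdef
  set S := hS.mk _ with hSdef
  have hSm : Measurable S := hS.measurable_mk
  have hhm : Measurable h := hh.measurable_mk
  have hgm : Measurable fun x => h x / S x := hhm.div hSm
  have hσ : volume.withDensity (sigmaWeight p w i) = volume.withDensity S :=
    withDensity_congr_ae hS.ae_eq_mk
  refine ⟨fun x => h x / S x, hgm, ?_, ?_⟩
  · rw [hσ, ← withDensity_mul _ hSm hgm]
    refine withDensity_congr_ae ?_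
    filter_upwards [hS.ae_eq_mk, hh.ae_eq_mk, hpos i] with x hx1 hx2 hx3
    simp only [Pi.mul_apply]
    rw [hx2, ← hhdef]
    refine ENNReal.mul_div_cancel ?_ ?_
    · rw [hSdef, ← hx1]; exact sigmaWeight_ne_zero hp w i x
    · rw [hSdef, ← hx1]
      exact ENNReal.rpow_ne_top_of_ne_zero (by simpa using hx3) ENNReal.ofReal_ne_top
  · rw [eLpNorm_eq_lintegral_rpow_enorm_toReal (by simpa using hp0) ENNReal.ofReal_ne_top,
      ENNReal.toReal_ofReal hp0.le, ← ENNReal.rpow_mul, one_div_mul_cancel hp0.ne',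
      ENNReal.rpow_one, sourceMeasure,
      lintegral_withDensity_eq_lintegral_mul₀ hW (hh.pow_const _), hσ,
      lintegral_withDensity_eq_lintegral_mul _ hSm (hgm.pow_const _)]
    refine lintegral_congr_ae ?_
    filter_upwards [hS.ae_eq_mk, hh.ae_eq_mk, hpos i] with x hx1 hx2 hx3
    simp only [Pi.mul_apply]
    rw [hx2, ← hhdef, hSdef, ← hx1, sigmaWeight, wpow, wpow,
      ENNReal.div_rpow_of_nonneg _ _ hp0.le, div_eq_mul_inv, mul_left_comm, mul_comm (_ ^ p i)]
    congr 1
    have hb0 : ENNReal.ofReal (w i x) ≠ 0 := by simpa using hx3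
    rw [← ENNReal.rpow_neg, ← ENNReal.rpow_mul, ← ENNReal.rpow_add _ _ hb0 ENNReal.ofReal_ne_top]
    congr 1
    rw [Real.conjExponent]
    field_simp
    ring

end Weights

/-- The exponent `p'_{i₀} (1 - α/n)` is at least one. -/
theorem one_le_conjExponent_mul {m : ℕ} {q τ : ℝ} {p : Fin m → ℝ} (hq : 0 < q) (hp : ∀ i, 1 < p i)
    (hsum : ∑ i, 1 / p i = 1 / q + τ) (i₀ : Fin m)
    (hgap : ∀ i, i ≠ i₀ → (p i).conjExponent ≤ (p i₀).conjExponent * (1 - τ)) :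
    1 ≤ (p i₀).conjExponent * (1 - τ) := by
  -- For `m = 1` the exponent is `1 + p' / q`.
  by_cases h : ∃ i, i ≠ i₀
  · obtain ⟨i, hi⟩ := h
    exact (Real.HolderConjugate.conjExponent (hp i)).symm.lt.le.trans (hgap i hi)
  · push Not at h
    have : Subsingleton (Fin m) := ⟨fun i j => (h i).trans (h j).symm⟩
    have hs : 1 / p i₀ = 1 / q + τ := by
      rw [← hsum, Fintype.sum_subsingleton _ i₀]
    have hpr := Real.HolderConjugate.conjExponent (hp i₀)
    have h1 := one_div_conj hpr
    have hr := hpr.symm.pos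
    have h2 : 1 - τ = 1 / (p i₀).conjExponent + 1 / q := by linarith
    rw [h2, mul_add, mul_one_div_cancel hr.ne']
    have : 0 ≤ (p i₀).conjExponent * (1 / q) := by positivity
    linarith

theorem eLpNorm_rpow_eq {X : Type*} [MeasurableSpace X] (M : X → ℝ≥0∞) (μ : Measure X) {q : ℝ}
    (hq : 0 < q) : eLpNorm M (ENNReal.ofReal q) μ = (∫⁻ x, M x ^ q ∂μ) ^ (1 / q) := by
  rw [eLpNorm_eq_lintegral_rpow_enorm_toReal (by simpa using hq) ENNReal.ofReal_ne_top,
    ENNReal.toReal_ofReal hq.le]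
  simp

/-- The weighted bound with the sharp exponent. -/
theorem exists_weightedBound {m n : ℕ} (α q : ℝ) (p : Fin m → ℝ)
    (hα : 0 < α) (hαn : α < n) (hq : 0 < q) (hp : ∀ i, 1 < p i)
    (hsum : ∑ i, 1 / p i = 1 / q + α / n) (i₀ : Fin m)
    (hgap : ∀ i, i ≠ i₀ → (p i).conjExponent ≤ (p i₀).conjExponent * (1 - α / n)) :
    ∃ C : ℝ≥0, WeightedBound n α q p ((1 - α / n) * ((p i₀).conjExponent / q)) C := by
  have hm : 0 < m := i₀.pos
  have hn' : (0 : ℝ) < n := by linarith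
  have hn : 0 < n := by exact_mod_cast hn'
  have hne : Nonempty (Fin m) := ⟨i₀⟩
  set τ := α / n with hτdef
  have hτ0 : 0 < τ := by positivity
  have hτ1 : τ < 1 := (div_lt_one hn').2 hαn
  set d := (m : ℝ) - τ with hddef
  have hm1 : (1 : ℝ) ≤ m := by exact_mod_cast hm
  have hd : 0 < d := by linarith
  have hpr : ∀ i, (p i).HolderConjugate (p i).conjExponent := fun i =>
    Real.HolderConjugate.conjExponent (hp i)
  set θ := (p i₀).conjExponent * (1 - τ) with hθ
  have hθ1 : 1 ≤ θ := one_le_conjExponent_mul hq hp hsum i₀ hgap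
  set C₀ : ℝ≥0∞ := ((6 ^ n) ^ d) ^ q * (2 ^ n * (2 ^ (d * q) * 2 ^ (d * q * (θ - 1)) *
        (∏ k, maxAvgConst (p k) ^ pieceExponent q τ p i₀ k))) with hC₀
  have hC₀t : C₀ ≠ ∞ := by
    have h6 : ((6 : ℝ≥0∞) ^ n) ≠ ∞ := ENNReal.pow_ne_top (by simp)
    have hdq : 0 ≤ d * q := by positivity
    refine ENNReal.mul_ne_top (ENNReal.rpow_ne_top_of_nonneg hq.le
      (ENNReal.rpow_ne_top_of_nonneg hd.le h6)) (ENNReal.mul_ne_top (ENNReal.pow_ne_top (by simp))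
      (ENNReal.mul_ne_top (ENNReal.mul_ne_top (ENNReal.rpow_ne_top_of_nonneg hdq (by simp))
        (ENNReal.rpow_ne_top_of_nonneg (mul_nonneg hdq (by linarith)) (by simp)))
        (ENNReal.prod_ne_top fun k _ => ENNReal.rpow_ne_top_of_nonneg
          (pieceExponent_nonneg hq hpr hθ hθ1 k) (maxAvgConst_ne_top (hp k)))))
  refine ⟨(C₀ ^ (1 / q)).toNNReal, fun w hw f hf => ?_⟩
  rw [ENNReal.coe_toNNReal (ENNReal.rpow_ne_top_of_nonneg (by positivity) hC₀t)]
  -- If `u_w` vanishes almost everywhere, the left-hand side is zero, although `[w]` is then finite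
  -- without any control on the `σᵢ`, because `0 * ∞ = 0`.
  by_cases hu : targetMeasure q w = 0
  · rw [hu, eLpNorm_measure_zero]; exact zero_le
  have hpos := ae_pos_of_memApq hq hp hw hu
  choose g hgm hgd hgG using exists_density_eq hp hw.isWeight hpos hf
  have hmain := lintegral_maxOn_rpow_le (A := apqConst p q w) hq hτ0.le hpr hsum hθ hθ1 hgap hd
    (by simp [hddef, hτ0.le]) (targetMeasure q w) (fun i => volume.withDensity (sigmaWeight p w i))
    g hgm hw.const_lt_top.ne (withDensity_absolutelyContinuous _ _)
    (fun i => withDensity_absolutelyContinuous _ _)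
    (fun a l hl => targetMeasure_cube_ne_top hq hp hw a hl)
    (fun i a l hl => withDensity_sigmaWeight_cube_ne_zero hp hw.isWeight i a hl)
    (fun i a l hl => withDensity_sigmaWeight_cube_ne_top hq hp hw hu i a l)
    (fun a l hl => apq_mass_le hq hp hsum a hl)
    (volume_rpow_le hq hp hsum hd hw.isWeight hpos)
    (fun i => by
      rw [hgG]
      exact (ENNReal.rpow_lt_top_of_nonneg (by linarith [hp i]) (hf i).2.ne))
  rw [eLpNorm_rpow_eq _ _ hq]
  simp only [hgd, hgG] at hmain
  simp only [maximalFn_eq_maxOn hm hn f, ← hτdef, ← hddef]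
  refine (ENNReal.rpow_le_rpow hmain (by positivity)).trans (le_of_eq ?_)
  have hq' : 0 ≤ 1 / q := by positivity
  have e : ∀ i, (eLpNorm (f i) (ENNReal.ofReal (p i)) (sourceMeasure p w i) ^ p i) ^ (q / p i) =
      eLpNorm (f i) (ENNReal.ofReal (p i)) (sourceMeasure p w i) ^ q := fun i => by
    rw [← ENNReal.rpow_mul]
    have : p i ≠ 0 := by linarith [hp i]
    congr 1; field_simp
  rw [Finset.prod_congr rfl fun i _ => e i, ENNReal.prod_rpow_of_nonneg hq.le]
  calc _ = (C₀ * apqConst p q w ^ θ *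
        (∏ i, eLpNorm (f i) (ENNReal.ofReal (p i)) (sourceMeasure p w i)) ^ q) ^ (1 / q) := by
        congr 1; rw [hC₀]; ring
    _ = _ := by
        rw [ENNReal.mul_rpow_of_nonneg _ _ hq', ENNReal.mul_rpow_of_nonneg _ _ hq',
          ← ENNReal.rpow_mul, ← ENNReal.rpow_mul, mul_one_div_cancel hq.ne', ENNReal.rpow_one]
        congr 3
        rw [hθ]; ring

/-! ### Power weights and extremal functions -/

section Radial

variable {n : ℕ}

/-- The integral of a power of the sup norm over a ball, in polar coordinates. -/
theorem lintegral_ball_norm_rpow (hn : 0 < n) {s R : ℝ} (hs : 0 < n + s) (hR : 0 < R) :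
    ∫⁻ x in Metric.ball (0 : Fin n → ℝ) R, ENNReal.ofReal (‖x‖ ^ s) =
      ENNReal.ofReal (n * 2 ^ n * (R ^ (n + s) / (n + s))) := by
  have : Nonempty (Fin n) := ⟨⟨0, hn⟩⟩
  have hdim : Module.finrank ℝ (Fin n → ℝ) = n := by simp
  have hpow : ∀ y ∈ Set.Ioo (0 : ℝ) R, y ^ (n + s - 1) = y ^ (n - 1) • y ^ s := fun y hy => by
    rw [smul_eq_mul, ← Real.rpow_natCast, ← Real.rpow_add hy.1, Nat.cast_sub hn]
    congr 1; push_cast; ring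
  have hint : IntegrableOn (fun x : Fin n → ℝ => ‖x‖ ^ s) (Metric.ball 0 R) volume := by
    rw [integrableOn_fun_norm_addHaar volume (f := fun y => y ^ s), hdim]
    rw [← integrableOn_congr_fun hpow measurableSet_Ioo,
      intervalIntegral.integrableOn_Ioo_rpow_iff hR]
    linarith
  rw [← ofReal_integral_eq_lintegral_ofReal hint
    (Filter.Eventually.of_forall fun x => Real.rpow_nonneg (norm_nonneg x) s)]
  congr 1
  have h1 : ∫ x in Metric.ball (0 : Fin n → ℝ) R, ‖x‖ ^ s =
      ∫ x : Fin n → ℝ, (Set.Iio R).indicator (fun y => y ^ s) ‖x‖ := by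
    rw [← integral_indicator Metric.isOpen_ball.measurableSet]
    congr 1
    funext x
    simp [Set.indicator]
  rw [h1, integral_fun_norm_addHaar volume ((Set.Iio R).indicator fun y => y ^ s), hdim]
  have h2 : ∫ y in Set.Ioi (0 : ℝ), y ^ (n - 1) • (Set.Iio R).indicator (fun y => y ^ s) y =
      ∫ y in Set.Ioo (0 : ℝ) R, y ^ (n + s - 1) := by
    rw [setIntegral_congr_fun measurableSet_Ioo hpow]
    have e : ∀ y : ℝ, y ^ (n - 1) • (Set.Iio R).indicator (fun y => y ^ s) y =
        (Set.Iio R).indicator (fun y => y ^ (n - 1) • y ^ s) y := fun y => by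
      by_cases hy : y < R <;> simp [hy]
    simp_rw [e]
    rw [setIntegral_indicator measurableSet_Iio, Set.Ioi_inter_Iio]
  have h3 : ∫ y in Set.Ioo (0 : ℝ) R, y ^ (n + s - 1) = R ^ (n + s) / (n + s) := by
    rw [← integral_Ioc_eq_integral_Ioo, ← intervalIntegral.integral_of_le hR.le,
      integral_rpow (Or.inl (by linarith))]
    rw [show n + s - 1 + 1 = n + s by ring, Real.zero_rpow hs.ne']
    simp
  have h4 : volume.real (Metric.ball (0 : Fin n → ℝ) 1) = 2 ^ n := by
    rw [Measure.real, Real.volume_pi_ball _ (by norm_num)]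
    simp
  rw [h2, h3, h4]
  simp [mul_assoc]

theorem norm_lt_of_mem_cube {a x : Fin n → ℝ} {l : ℝ} (hl : 0 < l) (hx : x ∈ cube a l) :
    ‖x‖ < ‖a‖ + l := by
  refine (pi_norm_lt_iff (by positivity)).2 fun k => ?_
  have h1 := hx k trivial
  have h2 := abs_le.1 ((Real.norm_eq_abs _).symm.trans_le (norm_le_pi_norm a k))
  rw [Real.norm_eq_abs, abs_lt]
  constructor <;> linarith [h1.1, h1.2, h2.1, h2.2]

theorem norm_sub_le_of_mem_cube {a x : Fin n → ℝ} {l : ℝ} (hl : 0 < l) (hx : x ∈ cube a l) :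
    ‖a‖ - l ≤ ‖x‖ := by
  have : ‖a‖ ≤ ‖x‖ + l := by
    refine (pi_norm_le_iff_of_nonneg (by positivity)).2 fun k => ?_
    have h1 := hx k trivial
    have h2 := abs_le.1 ((Real.norm_eq_abs _).symm.trans_le (norm_le_pi_norm x k))
    rw [Real.norm_eq_abs, abs_le]
    constructor <;> linarith [h1.1, h1.2, h2.1, h2.2]
  linarith

/-- The `A_1`-type estimate for `|x| ^ (ε - n)`: its average over a cube is at most `O(1/ε)` times
its lower bound `(‖a‖ + l) ^ (ε - n)` there. -/
theorem mul_setLIntegral_norm_rpow_le (hn : 0 < n) {ε : ℝ} (hε : 0 < ε) (hε1 : ε < 1)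
    (a : Fin n → ℝ) {l : ℝ} (hl : 0 < l) :
    ENNReal.ofReal ((‖a‖ + l) ^ (n - ε)) *
      ((∫⁻ x in cube a l, ENNReal.ofReal (‖x‖ ^ (ε - n))) / volume (cube a l)) ≤
      ENNReal.ofReal (n * 2 ^ n * 3 ^ n / ε) := by
  have hn1 : (1 : ℝ) ≤ n := by exact_mod_cast hn
  have hR : 0 < ‖a‖ + l := by positivity
  have hV0 := volume_cube_ne_zero a hl
  have hVt := volume_cube_ne_top a l
  -- Far from the origin the function is nearly constant on the cube; otherwise the cube is comparable
  -- to a ball centered at the origin.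
  rcases le_or_gt (2 * l) ‖a‖ with h | h
  · have havg : (∫⁻ x in cube a l, ENNReal.ofReal (‖x‖ ^ (ε - n))) / volume (cube a l) ≤
        ENNReal.ofReal (((‖a‖ + l) / 3) ^ (ε - n)) := by
      refine ENNReal.div_le_of_le_mul ?_
      rw [← setLIntegral_const]
      refine setLIntegral_mono' (measurableSet_cube a l) fun x hx => ?_
      refine ENNReal.ofReal_le_ofReal ?_
      refine Real.rpow_le_rpow_of_nonpos (by positivity) ?_ (by linarith)
      linarith [norm_sub_le_of_mem_cube hl hx]
    refine (mul_le_mul_right havg _).trans ?_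
    rw [← ENNReal.ofReal_mul (by positivity)]
    refine ENNReal.ofReal_le_ofReal ?_
    have e : (‖a‖ + l) ^ ((n : ℝ) - ε) * ((‖a‖ + l) / 3) ^ (ε - n) = 3 ^ ((n : ℝ) - ε) := by
      rw [Real.div_rpow hR.le (by norm_num), mul_div_assoc', ← Real.rpow_add hR,
        show (n : ℝ) - ε = -(ε - n) by ring, Real.rpow_neg (by norm_num : (0 : ℝ) ≤ 3)]
      simp
    rw [e]
    have h3 : (3 : ℝ) ^ ((n : ℝ) - ε) ≤ 3 ^ n := by
      rw [← Real.rpow_natCast]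
      exact Real.rpow_le_rpow_of_exponent_le (by norm_num) (by linarith)
    have h2n : (1 : ℝ) ≤ 2 ^ n := one_le_pow₀ (by norm_num)
    have h3n : (0 : ℝ) < 3 ^ n := by positivity
    rw [le_div_iff₀ hε]
    have h5 : (1 : ℝ) ≤ n * 2 ^ n := by nlinarith
    calc (3 : ℝ) ^ ((n : ℝ) - ε) * ε ≤ 3 ^ n * 1 :=
          mul_le_mul h3 hε1.le hε.le h3n.le
      _ ≤ n * 2 ^ n * 3 ^ n := by nlinarith
  · have hsub : cube a l ⊆ Metric.ball 0 (‖a‖ + l) := fun x hx =>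
      mem_ball_zero_iff.2 (norm_lt_of_mem_cube hl hx)
    have hint : ∫⁻ x in cube a l, ENNReal.ofReal (‖x‖ ^ (ε - n)) ≤
        ENNReal.ofReal (n * 2 ^ n * ((‖a‖ + l) ^ ε / ε)) := by
      refine (lintegral_mono_set hsub).trans (le_of_eq ?_)
      rw [lintegral_ball_norm_rpow hn (by linarith) hR]
      congr 5 <;> ring
    rw [← mul_div_assoc]
    refine ENNReal.div_le_of_le_mul ((mul_le_mul_right hint _).trans ?_)
    rw [volume_cube, ← ENNReal.ofReal_pow hl.le, ← ENNReal.ofReal_mul (by positivity),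
      ← ENNReal.ofReal_mul (by positivity)]
    refine ENNReal.ofReal_le_ofReal ?_
    have e : (‖a‖ + l) ^ ((n : ℝ) - ε) * (n * 2 ^ n * ((‖a‖ + l) ^ ε / ε)) =
        n * 2 ^ n / ε * (‖a‖ + l) ^ n := by
      rw [← Real.rpow_natCast (‖a‖ + l) n]
      conv_rhs => rw [show (n : ℝ) = (n - ε) + ε by ring, Real.rpow_add hR]
      simp only [sub_add_cancel]
      ring
    rw [e]
    have h3 : (‖a‖ + l) ^ n ≤ 3 ^ n * l ^ n := by
      rw [← mul_pow]
      exact pow_le_pow_left₀ hR.le (by linarith) n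
    calc n * 2 ^ n / ε * (‖a‖ + l) ^ n ≤ n * 2 ^ n / ε * (3 ^ n * l ^ n) := by gcongr
      _ = _ := by ring

end Radial

section PowerWeights

variable {m n : ℕ}

/-- The extremal weights: a nearly critical power at the index `i₀`, and `1` elsewhere. -/
noncomputable def powerWeight (p : Fin m → ℝ) (i₀ : Fin m) (ε : ℝ) (i : Fin m) (x : Fin n → ℝ) : ℝ :=
  if i = i₀ then ‖x‖ ^ ((n - ε) / (p i₀).conjExponent) else 1

/-- The exponents of the extremal functions. -/
noncomputable def testExponent (n : ℕ) (p : Fin m → ℝ) (i₀ : Fin m) (ε : ℝ) (i : Fin m) : ℝ :=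
  if i = i₀ then ε - n else ε - n / p i

/-- The extremal functions: powers of the norm, restricted to the unit ball. -/
noncomputable def testFn (p : Fin m → ℝ) (i₀ : Fin m) (ε : ℝ) (i : Fin m) (x : Fin n → ℝ) : ℂ :=
  (Metric.ball (0 : Fin n → ℝ) 1).indicator (fun x => ((‖x‖ ^ testExponent n p i₀ ε i : ℝ) : ℂ)) x

variable {p : Fin m → ℝ} {i₀ : Fin m} {ε q : ℝ}

theorem isWeight_powerWeight (hp : ∀ i, 1 < p i) (hεn : ε < n) (i : Fin m) :
    IsWeight (powerWeight (n := n) p i₀ ε i) := by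
  have hr := (Real.HolderConjugate.conjExponent (hp i₀)).symm.pos
  refine ⟨fun x => ?_, ?_⟩
  · unfold powerWeight; split_ifs <;> positivity
  · refine Continuous.locallyIntegrable ?_
    unfold powerWeight
    split_ifs
    · exact continuous_norm.rpow_const fun _ => Or.inr (div_nonneg (by linarith) hr.le)
    · exact continuous_const

theorem uWeight_powerWeight (hq : 0 < q) (x : Fin n → ℝ) :
    uWeight q (powerWeight p i₀ ε) x =
      ENNReal.ofReal (‖x‖ ^ ((n - ε) * (q / (p i₀).conjExponent))) := by
  simp only [uWeight, wpow, powerWeight, Finset.prod_ite_eq', Finset.mem_univ, if_true]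
  rw [ENNReal.ofReal_rpow_of_nonneg (by positivity) hq.le, ← Real.rpow_mul (norm_nonneg x)]
  congr 2; ring

theorem sigmaWeight_powerWeight_self (hp : ∀ i, 1 < p i) {x : Fin n → ℝ} (hx : x ≠ 0) :
    sigmaWeight p (powerWeight p i₀ ε) i₀ x = ENNReal.ofReal (‖x‖ ^ (ε - n)) := by
  have hr := (Real.HolderConjugate.conjExponent (hp i₀)).symm.pos
  simp only [sigmaWeight, wpow, powerWeight, if_true]
  rw [ENNReal.ofReal_rpow_of_pos (by positivity), ← Real.rpow_mul (norm_nonneg x)]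
  congr 2; field_simp; ring

theorem sigmaWeight_powerWeight_of_ne {i : Fin m} (hi : i ≠ i₀) (x : Fin n → ℝ) :
    sigmaWeight p (powerWeight p i₀ ε) i x = 1 := by
  simp [sigmaWeight, wpow, powerWeight, hi]

theorem ae_ne_zero (hn : 0 < n) : ∀ᵐ x : Fin n → ℝ, x ≠ 0 := by
  have : Nonempty (Fin n) := ⟨⟨0, hn⟩⟩
  rw [ae_iff]
  simp

theorem cubeAvg_sigmaWeight_self (hn : 0 < n) (hp : ∀ i, 1 < p i) (a : Fin n → ℝ) (l : ℝ) :
    cubeAvg (sigmaWeight p (powerWeight p i₀ ε) i₀) a l =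
      (∫⁻ x in cube a l, ENNReal.ofReal (‖x‖ ^ (ε - n))) / volume (cube a l) := by
  rw [cubeAvg]
  congr 1
  refine lintegral_congr_ae (ae_restrict_of_ae ?_)
  filter_upwards [ae_ne_zero hn] with x hx
  exact sigmaWeight_powerWeight_self hp hx

theorem apq_product_powerWeight (a : Fin n → ℝ) {l : ℝ} (hl : 0 < l) :
    cubeAvg (uWeight q (powerWeight p i₀ ε)) a l *
      ∏ i, cubeAvg (sigmaWeight p (powerWeight p i₀ ε) i) a l ^ (q / (p i).conjExponent) =
    cubeAvg (uWeight q (powerWeight p i₀ ε)) a l *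
      cubeAvg (sigmaWeight p (powerWeight p i₀ ε) i₀) a l ^ (q / (p i₀).conjExponent) := by
  congr 1
  refine Finset.prod_eq_single i₀ (fun i _ hi => ?_) (fun h => absurd (Finset.mem_univ _) h)
  have : cubeAvg (sigmaWeight p (powerWeight p i₀ ε) i) a l = 1 := by
    rw [cubeAvg]
    simp_rw [sigmaWeight_powerWeight_of_ne hi]
    rw [setLIntegral_one, ENNReal.div_self (volume_cube_ne_zero a hl) (volume_cube_ne_top a l)]
  rw [this, ENNReal.one_rpow]

theorem apqConst_powerWeight_le (hn : 0 < n) (hq : 0 < q) (hp : ∀ i, 1 < p i) (hε : 0 < ε)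
    (hε1 : ε < 1) : apqConst p q (powerWeight (n := n) p i₀ ε) ≤
      ENNReal.ofReal (n * 2 ^ n * 3 ^ n / ε) ^ (q / (p i₀).conjExponent) := by
  have hr := (Real.HolderConjugate.conjExponent (hp i₀)).symm.pos
  have hb : 0 < q / (p i₀).conjExponent := div_pos hq hr
  have hn1 : (1 : ℝ) ≤ n := by exact_mod_cast hn
  refine iSup_le fun a => iSup_le fun l => iSup_le fun hl => ?_
  have hR : 0 < ‖a‖ + l := by positivity
  rw [apq_product_powerWeight a hl]
  have hu : cubeAvg (uWeight q (powerWeight p i₀ ε)) a l ≤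
      ENNReal.ofReal ((‖a‖ + l) ^ (n - ε)) ^ (q / (p i₀).conjExponent) := by
    refine ENNReal.div_le_of_le_mul ?_
    rw [← setLIntegral_const]
    refine setLIntegral_mono' (measurableSet_cube a l) fun x hx => ?_
    rw [uWeight_powerWeight hq, ENNReal.ofReal_rpow_of_nonneg (by positivity) hb.le,
      ← Real.rpow_mul hR.le]
    refine ENNReal.ofReal_le_ofReal (Real.rpow_le_rpow (norm_nonneg x)
      (norm_lt_of_mem_cube hl hx).le (mul_nonneg (by linarith) hb.le))
  refine (mul_le_mul_left hu _).trans ?_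
  rw [← ENNReal.mul_rpow_of_nonneg _ _ hb.le, cubeAvg_sigmaWeight_self hn hp]
  exact ENNReal.rpow_le_rpow (mul_setLIntegral_norm_rpow_le hn hε hε1 a hl) hb.le

theorem le_apqConst_powerWeight (hn : 0 < n) (hq : 0 < q) (hp : ∀ i, 1 < p i) (hε : 0 < ε)
    (hε1 : ε < 1) : ENNReal.ofReal ((1 / 2) ^ n) ^ (q / (p i₀).conjExponent) ≤
      apqConst p q (powerWeight (n := n) p i₀ ε) := by
  have hr := (Real.HolderConjugate.conjExponent (hp i₀)).symm.pos
  have hb : 0 < q / (p i₀).conjExponent := div_pos hq hr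
  have hn1 : (1 : ℝ) ≤ n := by exact_mod_cast hn
  have : Nonempty (Fin n) := ⟨⟨0, hn⟩⟩
  -- A cube on which the norm lies between `1` and `2`.
  set a : Fin n → ℝ := fun _ => 1 with ha
  have hV0 := volume_cube_ne_zero a one_pos
  have hVt := volume_cube_ne_top a 1
  have hlow : ∀ x ∈ cube a 1, 1 ≤ ‖x‖ := fun x hx =>
    ((hx ⟨0, hn⟩ trivial).1.le.trans (le_abs_self _)).trans (norm_le_pi_norm x ⟨0, hn⟩)
  have hup : ∀ x ∈ cube a 1, ‖x‖ ≤ 2 := fun x hx => by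
    have := norm_lt_of_mem_cube one_pos hx
    have h1 : ‖a‖ = 1 := by rw [ha, pi_norm_const]; simp
    linarith
  refine le_trans ?_ (cubeAvg_mul_prod_le p q _ a one_pos)
  rw [apq_product_powerWeight a one_pos]
  have hu : 1 ≤ cubeAvg (uWeight q (powerWeight p i₀ ε)) a 1 := by
    rw [cubeAvg, ENNReal.le_div_iff_mul_le (Or.inl hV0) (Or.inl hVt), ← setLIntegral_const]
    refine setLIntegral_mono' (measurableSet_cube a 1) fun x hx => ?_
    rw [uWeight_powerWeight hq, ← ENNReal.ofReal_one]
    exact ENNReal.ofReal_le_ofReal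
      (Real.one_le_rpow (hlow x hx) (mul_nonneg (by linarith) hb.le))
  have hs : ENNReal.ofReal ((1 / 2) ^ n) ≤
      cubeAvg (sigmaWeight p (powerWeight p i₀ ε) i₀) a 1 := by
    rw [cubeAvg_sigmaWeight_self hn hp, ENNReal.le_div_iff_mul_le (Or.inl hV0) (Or.inl hVt),
      ← setLIntegral_const]
    refine setLIntegral_mono' (measurableSet_cube a 1) fun x hx => ?_
    refine ENNReal.ofReal_le_ofReal ?_
    have hx0 : 0 < ‖x‖ := lt_of_lt_of_le one_pos (hlow x hx)
    calc ((1 : ℝ) / 2) ^ n = 2 ^ (-(n : ℝ)) := by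
          rw [Real.rpow_neg (by norm_num), Real.rpow_natCast, one_div, inv_pow]
      _ ≤ 2 ^ (ε - n) := Real.rpow_le_rpow_of_exponent_le (by norm_num) (by linarith)
      _ ≤ ‖x‖ ^ (ε - n) := Real.rpow_le_rpow_of_nonpos hx0 (hup x hx) (by linarith)
  calc _ = 1 * ENNReal.ofReal ((1 / 2) ^ n) ^ (q / (p i₀).conjExponent) := (one_mul _).symm
    _ ≤ _ := mul_le_mul' hu (ENNReal.rpow_le_rpow hs hb.le)

theorem memApq_powerWeight (hn : 0 < n) (hq : 0 < q) (hp : ∀ i, 1 < p i) (hε : 0 < ε)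
    (hε1 : ε < 1) : MemApq p q (powerWeight (n := n) p i₀ ε) := by
  have hr := (Real.HolderConjugate.conjExponent (hp i₀)).symm.pos
  have hn1 : (1 : ℝ) ≤ n := by exact_mod_cast hn
  exact ⟨isWeight_powerWeight hp (by linarith),
    (apqConst_powerWeight_le hn hq hp hε hε1).trans_lt
      (ENNReal.rpow_lt_top_of_nonneg (div_pos hq hr).le ENNReal.ofReal_ne_top)⟩

theorem measurable_testFn (i : Fin m) : Measurable (testFn (n := n) p i₀ ε i) := by
  refine Measurable.indicator ?_ Metric.isOpen_ball.measurableSet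
  fun_prop

theorem enorm_testFn (i : Fin m) (x : Fin n → ℝ) : ‖testFn p i₀ ε i x‖ₑ =
    (Metric.ball (0 : Fin n → ℝ) 1).indicator
      (fun x => ENNReal.ofReal (‖x‖ ^ testExponent n p i₀ ε i)) x := by
  unfold testFn
  by_cases hx : x ∈ Metric.ball (0 : Fin n → ℝ) 1
  · rw [Set.indicator_of_mem hx, Set.indicator_of_mem hx, ← ofReal_norm,
      Complex.norm_real, Real.norm_of_nonneg (by positivity)]
  · simp [Set.indicator_of_notMem hx]

theorem eLpNorm_testFn_le (hn : 0 < n) (hp : ∀ i, 1 < p i) (hε : 0 < ε) (hε1 : ε < 1)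
    (i : Fin m) : eLpNorm (testFn (n := n) p i₀ ε i) (ENNReal.ofReal (p i))
      (sourceMeasure p (powerWeight p i₀ ε) i) ≤
        ENNReal.ofReal (n * 2 ^ n / ε) ^ (1 / p i) := by
  have hn1 : (1 : ℝ) ≤ n := by exact_mod_cast hn
  have hp0 : 0 < p i := by linarith [hp i]
  have hpr := Real.HolderConjugate.conjExponent (hp i₀)
  rw [eLpNorm_eq_lintegral_rpow_enorm_toReal (by simpa using hp0) ENNReal.ofReal_ne_top,
    ENNReal.toReal_ofReal hp0.le]
  refine ENNReal.rpow_le_rpow ?_ (by positivity)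
  rw [sourceMeasure, lintegral_withDensity_eq_lintegral_mul₀
    (aemeasurable_wpow (isWeight_powerWeight hp (by linarith) i) _)
    ((measurable_testFn i).enorm.pow_const _).aemeasurable]
  -- The power of the norm appearing in the integral.
  set t : ℝ := if i = i₀ then ε - n else ε * p i - n with ht
  have hint : ∫⁻ x, wpow (powerWeight p i₀ ε i) (p i) x * ‖testFn (n := n) p i₀ ε i x‖ₑ ^ p i =
      ∫⁻ x in Metric.ball (0 : Fin n → ℝ) 1, ENNReal.ofReal (‖x‖ ^ t) := by
    rw [← lintegral_indicator Metric.isOpen_ball.measurableSet]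
    refine lintegral_congr_ae ?_
    filter_upwards [ae_ne_zero hn] with x hx
    have hx0 : 0 < ‖x‖ := norm_pos_iff.2 hx
    simp only [enorm_testFn]
    by_cases hxb : x ∈ Metric.ball (0 : Fin n → ℝ) 1
    · rw [Set.indicator_of_mem hxb, Set.indicator_of_mem hxb, wpow]
      by_cases hi : i = i₀
      · subst hi
        simp only [powerWeight, testExponent, if_true, ht]
        rw [ENNReal.ofReal_rpow_of_pos (by positivity),
          ENNReal.ofReal_rpow_of_pos (by positivity), ← ENNReal.ofReal_mul (by positivity),
          ← Real.rpow_mul hx0.le, ← Real.rpow_mul hx0.le, ← Real.rpow_add hx0]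
        congr 2
        rw [Real.conjExponent]
        field_simp
        ring
      · simp only [powerWeight, testExponent, hi, if_false, ht]
        rw [ENNReal.ofReal_one, ENNReal.one_rpow, one_mul,
          ENNReal.ofReal_rpow_of_pos (by positivity), ← Real.rpow_mul hx0.le]
        congr 2
        field_simp
    · rw [Set.indicator_of_notMem hxb, Set.indicator_of_notMem hxb,
        ENNReal.zero_rpow_of_pos hp0, mul_zero]
  simp only [Pi.mul_apply]
  rw [hint]
  have htn : ε ≤ n + t := by
    rw [ht]
    split_ifs
    · linarith
    · nlinarith [hp i]
  rw [lintegral_ball_norm_rpow hn (by linarith) one_pos, Real.one_rpow, mul_one_div]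
  exact ENNReal.ofReal_le_ofReal (by gcongr)

theorem memSource_testFn (hn : 0 < n) (hp : ∀ i, 1 < p i) (hε : 0 < ε) (hε1 : ε < 1) :
    MemSource p (powerWeight (n := n) p i₀ ε) (testFn p i₀ ε) := fun i =>
  ⟨(measurable_testFn i).aestronglyMeasurable, (eLpNorm_testFn_le hn hp hε hε1 i).trans_lt
    (ENNReal.rpow_lt_top_of_nonneg (one_div_pos.2 (by linarith [hp i])).le ENNReal.ofReal_ne_top)⟩

theorem sum_testExponent {τ : ℝ} (hp : ∀ i, 1 < p i) (hsum : ∑ i, 1 / p i = 1 / q + τ) :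
    ∑ i, testExponent n p i₀ ε i =
      m * ε - n / (p i₀).conjExponent - n / q - n * τ := by
  have h : ∀ i, testExponent n p i₀ ε i =
      ε - n * (1 / p i) - if i = i₀ then n * (1 - 1 / p i) else 0 := fun i => by
    unfold testExponent; split_ifs <;> ring
  simp_rw [h]
  rw [Finset.sum_sub_distrib, Finset.sum_sub_distrib, ← Finset.mul_sum, hsum, Finset.sum_ite_eq',
    if_pos (Finset.mem_univ _), ← one_div_conj (Real.HolderConjugate.conjExponent (hp i₀))]
  simp only [Finset.sum_const, Finset.card_univ, Fintype.card_fin, nsmul_eq_mul]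
  ring

/-- Testing the maximal function at `x` on the cube of side length `4 ‖x‖` centered at the origin. -/
theorem le_maximalFn_testFn {α : ℝ} (hn : 0 < n) (hq : 0 < q) (hp : ∀ i, 1 < p i)
    (hαn : α < n) (hsum : ∑ i, 1 / p i = 1 / q + α / n) (hε : 0 < ε) (hε1 : ε < 1)
    {x : Fin n → ℝ} (hx0 : x ≠ 0) (hx1 : ‖x‖ < 1) :
    ENNReal.ofReal ((1 / (n + 1)) ^ m * (4 ^ n) ^ (-((m : ℝ) - α / n)) / ε *
      ‖x‖ ^ (m * ε - n / (p i₀).conjExponent - n / q)) ≤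
      maximalFn α (testFn (n := n) p i₀ ε) x := by
  have hm : 0 < m := i₀.pos
  have hn0 : (0 : ℝ) < n := by exact_mod_cast hn
  have hm1 : (1 : ℝ) ≤ m := by exact_mod_cast hm
  have hn1 : (1 : ℝ) ≤ n := by exact_mod_cast hn
  set d := (m : ℝ) - α / n with hd
  have hd0 : 0 < d := by
    have : α / n < 1 := (div_lt_one hn0).2 hαn
    linarith
  set ρ := ‖x‖ with hρ
  have hρ0 : 0 < ρ := norm_pos_iff.2 hx0
  set a : Fin n → ℝ := fun _ => -(2 * ρ) with ha
  have hsub : ∀ y : Fin n → ℝ, ‖y‖ ≤ ρ → y ∈ cube a (4 * ρ) := fun y hy k _ => by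
    have := abs_le.1 ((Real.norm_eq_abs _).symm.trans_le ((norm_le_pi_norm y k).trans hy))
    simp only [ha]
    constructor <;> linarith [this.1, this.2]
  have hexp : ∀ i, 0 < n + testExponent n p i₀ ε i := fun i => by
    unfold testExponent
    have : (n : ℝ) / p i < n := div_lt_self hn0 (hp i)
    split_ifs <;> linarith
  let c : Fin m → ℝ := fun i => if i = i₀ then 1 / ε else 1
  have hc0 : ∀ i, 0 ≤ c i := fun i => by simp only [c]; split_ifs <;> positivity
  have hmass : ∀ i, ENNReal.ofReal (1 / (n + 1) * c i * ρ ^ (n + testExponent n p i₀ ε i)) ≤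
      volume.withDensity (fun y => ‖testFn (n := n) p i₀ ε i y‖ₑ) (cube a (4 * ρ)) := fun i => by
    rw [withDensity_cube]
    calc _ ≤ ∫⁻ y in Metric.ball (0 : Fin n → ℝ) ρ,
          ENNReal.ofReal (‖y‖ ^ testExponent n p i₀ ε i) := by
          rw [lintegral_ball_norm_rpow hn (hexp i) hρ0]
          refine ENNReal.ofReal_le_ofReal ?_
          have hpow : 0 < ρ ^ (n + testExponent n p i₀ ε i) := Real.rpow_pos_of_pos hρ0 _
          have h2n : (1 : ℝ) ≤ 2 ^ n := one_le_pow₀ (by norm_num)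
          have h5 : (1 : ℝ) ≤ n * 2 ^ n := by nlinarith
          have hle : 1 / (n + 1) * c i ≤ 1 / (n + testExponent n p i₀ ε i) := by
            simp only [c, testExponent]
            split_ifs with h
            · rw [show (n : ℝ) + (ε - n) = ε by ring]
              refine mul_le_of_le_one_left (by positivity) ?_
              rw [div_le_one (by linarith)]; linarith
            · have h6 : 0 < n / p i := div_pos hn0 (by linarith [hp i])
              have := hexp i
              simp only [testExponent, h, if_false] at this
              rw [mul_one]
              exact one_div_le_one_div_of_le this (by linarith)
          calc _ ≤ 1 / (n + testExponent n p i₀ ε i) * ρ ^ (n + testExponent n p i₀ ε i) :=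
                mul_le_mul_of_nonneg_right hle hpow.le
            _ = 1 * (ρ ^ (n + testExponent n p i₀ ε i) / (n + testExponent n p i₀ ε i)) := by ring
            _ ≤ _ := mul_le_mul_of_nonneg_right h5 (div_pos hpow (hexp i)).le
      _ = ∫⁻ y in Metric.ball (0 : Fin n → ℝ) ρ, ‖testFn (n := n) p i₀ ε i y‖ₑ := by
          refine setLIntegral_congr_fun Metric.isOpen_ball.measurableSet fun y hy => ?_
          have : y ∈ Metric.ball (0 : Fin n → ℝ) 1 := Metric.ball_subset_ball hx1.le hy
          simp only [enorm_testFn, Set.indicator_of_mem this]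
      _ ≤ _ := lintegral_mono_set fun y hy => hsub y (mem_ball_zero_iff.1 hy).le
  rw [maximalFn_eq_maxOn hm hn]
  refine le_trans ?_ (le_iSup_of_le a (le_iSup_of_le (4 * ρ) (le_iSup_of_le
    (show 4 * ρ ∈ Set.Ioi (0 : ℝ) from by simpa using hρ0)
    (le_iSup_of_le (hsub x le_rfl) le_rfl))))
  unfold fracAvg
  rw [← hd, ENNReal.le_div_iff_mul_le
    (Or.inl (rpow_ne_zero_of_pos (volume_cube_ne_zero a (by positivity)) hd0))
    (Or.inl (ENNReal.rpow_ne_top_of_nonneg hd0.le (volume_cube_ne_top a _)))]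
  refine le_trans (le_of_eq ?_) (Finset.prod_le_prod' fun i _ => hmass i)
  rw [volume_cube, ← ENNReal.ofReal_pow (by positivity),
    ENNReal.ofReal_rpow_of_pos (by positivity), ← ENNReal.ofReal_mul (by positivity),
    ← ENNReal.ofReal_prod_of_nonneg fun i _ =>
      mul_nonneg (mul_nonneg (by positivity) (hc0 i)) (by positivity)]
  congr 1
  rw [Finset.prod_mul_distrib, Finset.prod_mul_distrib, Finset.prod_const, Finset.card_univ,
    Fintype.card_fin, Finset.prod_ite_eq', if_pos (Finset.mem_univ _),
    ← Real.rpow_sum_of_pos hρ0, Finset.sum_add_distrib, sum_testExponent hp hsum, mul_pow,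
    Real.mul_rpow (by positivity) (by positivity), Real.rpow_neg (by positivity)]
  have e : ρ ^ (∑ _i : Fin m, (n : ℝ) + (m * ε - n / (p i₀).conjExponent - n / q - n * (α / n))) =
      ρ ^ (m * ε - n / (p i₀).conjExponent - n / q) * (ρ ^ n) ^ d := by
    rw [← Real.rpow_natCast, ← Real.rpow_mul hρ0.le, ← Real.rpow_add hρ0]
    congr 1
    simp only [Finset.sum_const, Finset.card_univ, Fintype.card_fin, nsmul_eq_mul]
    rw [hd]; ring
  rw [e]
  field_simp

end PowerWeights

/-! ### Sharpness of the exponent -/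

section Sharpness

variable {m n : ℕ} {p : Fin m → ℝ} {i₀ : Fin m} {ε q : ℝ}

/-- The norm of the maximal function of the extremal functions is at least of order
`ε ^ (-1 - 1/q)`. -/
theorem le_eLpNorm_maximalFn_testFn {α : ℝ} (hn : 0 < n) (hq : 0 < q) (hp : ∀ i, 1 < p i)
    (hαn : α < n) (hsum : ∑ i, 1 / p i = 1 / q + α / n) (hε : 0 < ε) (hε1 : ε < 1) :
    ENNReal.ofReal ((1 / (n + 1)) ^ m * (4 ^ n) ^ (-((m : ℝ) - α / n)) * (1 / (q * m)) ^ (1 / q) *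
      ε ^ (-(1 + 1 / q))) ≤
      eLpNorm (maximalFn α (testFn (n := n) p i₀ ε)) (ENNReal.ofReal q)
        (targetMeasure q (powerWeight p i₀ ε)) := by
  have hm : 0 < m := i₀.pos
  have hm1 : (1 : ℝ) ≤ m := by exact_mod_cast hm
  have hn1 : (1 : ℝ) ≤ n := by exact_mod_cast hn
  have hpr := Real.HolderConjugate.conjExponent (hp i₀)
  have hr := hpr.symm.pos
  have hr1 : 1 / (p i₀).conjExponent < 1 := (div_lt_one hr).2 hpr.symm.lt
  have hr0 : 0 < 1 / (p i₀).conjExponent := by positivity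
  set κ : ℝ := (1 / (n + 1)) ^ m * (4 ^ n) ^ (-((m : ℝ) - α / n)) with hκ
  set r := (p i₀).conjExponent with hrdef
  set e : ℝ := m * ε - n / r - n / q with he
  -- The exponent of the norm in `(M_α f) ^ q u_w`, slightly larger than the critical `-n`.
  set t : ℝ := -n + q * ε * (m - 1 / r) with ht
  have hgapt : 0 < q * ε * (m - 1 / r) := mul_pos (by positivity) (by linarith)
  have hgapt' : q * ε * (m - 1 / r) ≤ q * m * ε := by nlinarith [mul_pos hq hε]
  have hw : ∀ i, IsWeight (powerWeight (n := n) p i₀ ε i) := isWeight_powerWeight hp (by linarith)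
  rw [eLpNorm_rpow_eq _ _ hq, targetMeasure,
    lintegral_withDensity_eq_lintegral_mul₀ (aemeasurable_uWeight q hw)
      ((measurable_maximalFn hm hn _).pow_const q).aemeasurable]
  have hlow : ENNReal.ofReal ((κ / ε) ^ q * (1 / (q * m * ε))) ≤
      ∫⁻ x in Metric.ball (0 : Fin n → ℝ) 1, uWeight q (powerWeight p i₀ ε) x *
        maximalFn α (testFn (n := n) p i₀ ε) x ^ q := by
    have hn2 : (1 : ℝ) ≤ n * 2 ^ n := by
      have h2n : (1 : ℝ) ≤ 2 ^ n := one_le_pow₀ (by norm_num)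
      nlinarith
    calc ENNReal.ofReal ((κ / ε) ^ q * (1 / (q * m * ε)))
        ≤ ENNReal.ofReal ((κ / ε) ^ q * (n * 2 ^ n * ((1 : ℝ) ^ (n + t) / (n + t)))) := by
          refine ENNReal.ofReal_le_ofReal (mul_le_mul_of_nonneg_left ?_ (by positivity))
          rw [Real.one_rpow, show n + t = q * ε * (m - 1 / r) by rw [ht]; ring]
          have h1 : 1 / (q * m * ε) ≤ 1 / (q * ε * (m - 1 / r)) :=
            one_div_le_one_div_of_le hgapt hgapt'
          have h2 : 0 < 1 / (q * ε * (m - 1 / r)) := one_div_pos.2 hgapt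
          nlinarith
      _ = ∫⁻ x in Metric.ball (0 : Fin n → ℝ) 1,
            ENNReal.ofReal ((κ / ε) ^ q) * ENNReal.ofReal (‖x‖ ^ t) := by
          rw [lintegral_const_mul' _ _ ENNReal.ofReal_ne_top,
            lintegral_ball_norm_rpow hn (by rw [ht]; linarith) one_pos,
            ENNReal.ofReal_mul (by positivity)]
      _ ≤ _ := by
          refine lintegral_mono_ae ?_
          filter_upwards [ae_restrict_mem Metric.isOpen_ball.measurableSet,
            ae_restrict_of_ae (ae_ne_zero hn)] with x hx1 hx0
          have hx : 0 < ‖x‖ := norm_pos_iff.2 hx0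
          have hM := le_maximalFn_testFn (i₀ := i₀) hn hq hp hαn hsum hε hε1 hx0
            (mem_ball_zero_iff.1 hx1)
          rw [uWeight_powerWeight hq]
          refine le_trans (le_of_eq ?_) (mul_le_mul_right (ENNReal.rpow_le_rpow hM hq.le) _)
          rw [← hκ, ← hrdef, ← he, ENNReal.ofReal_rpow_of_pos (by positivity),
            ← ENNReal.ofReal_mul (by positivity), ← ENNReal.ofReal_mul (by positivity),
            Real.mul_rpow (by positivity) (by positivity), ← Real.rpow_mul hx.le]
          congr 1
          rw [mul_left_comm, ← Real.rpow_add hx]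
          congr 2
          rw [ht, he]
          field_simp
          ring
  have hcomp := ENNReal.rpow_le_rpow (hlow.trans (setLIntegral_le_lintegral _ _))
    (show 0 ≤ 1 / q by positivity)
  refine le_trans (le_of_eq ?_) hcomp
  rw [ENNReal.ofReal_rpow_of_pos (by positivity)]
  congr 1
  rw [Real.mul_rpow (by positivity) (by positivity), ← Real.rpow_mul (by positivity),
    mul_one_div_cancel hq.ne', Real.rpow_one, show 1 / (q * m * ε) = 1 / (q * m) * ε⁻¹ by
      field_simp, Real.mul_rpow (by positivity) (by positivity), neg_add, Real.rpow_add hε,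
    Real.rpow_neg_one, Real.rpow_neg hε.le, Real.inv_rpow hε.le]
  ring

/-- Every power of the weight constant of the extremal weights is at most of order `ε ^ (-γ)`, where
`γ` is the exponent expected from `[w] ∼ ε ^ (-q/p'_{i₀})`, or `0` if the power is negative. -/
theorem apqConst_powerWeight_rpow_le (hn : 0 < n) (hq : 0 < q) (hp : ∀ i, 1 < p i) (β : ℝ) :
    ∃ L : ℝ, 0 < L ∧ ∀ ε : ℝ, 0 < ε → ε < 1 →
      apqConst p q (powerWeight (n := n) p i₀ ε) ^ β ≤
        ENNReal.ofReal (L * ε ^ (-(q / (p i₀).conjExponent * max β 0))) := by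
  have hr := (Real.HolderConjugate.conjExponent (hp i₀)).symm.pos
  set b := q / (p i₀).conjExponent with hb
  rcases le_total 0 β with hβ | hβ
  · refine ⟨(n * 2 ^ n * 3 ^ n) ^ (b * β), by positivity, fun ε hε hε1 => ?_⟩
    refine (ENNReal.rpow_le_rpow (apqConst_powerWeight_le hn hq hp hε hε1) hβ).trans (le_of_eq ?_)
    have hpos : (0 : ℝ) < n * 2 ^ n * 3 ^ n / ε := by positivity
    rw [← hb, ← ENNReal.rpow_mul, ENNReal.ofReal_rpow_of_pos hpos, max_eq_left hβ,
      Real.div_rpow (by positivity) hε.le, Real.rpow_neg hε.le, div_eq_mul_inv]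
  · refine ⟨((1 / 2) ^ n) ^ (b * β), by positivity, fun ε hε hε1 => ?_⟩
    rw [max_eq_right hβ, mul_zero, neg_zero, Real.rpow_zero, mul_one]
    have hlow := le_apqConst_powerWeight (i₀ := i₀) hn hq hp hε hε1
    have hanti : apqConst p q (powerWeight (n := n) p i₀ ε) ^ β ≤
        (ENNReal.ofReal ((1 / 2) ^ n) ^ b) ^ β := by
      have h := ENNReal.inv_le_inv.2 (ENNReal.rpow_le_rpow hlow (neg_nonneg.2 hβ))
      rwa [← ENNReal.rpow_neg, ← ENNReal.rpow_neg, neg_neg] at h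
    refine hanti.trans (le_of_eq ?_)
    rw [← ENNReal.rpow_mul, ENNReal.ofReal_rpow_of_pos (by positivity)]

/-- No smaller exponent of the weight constant is possible. -/
theorem not_exists_weightedBound {α : ℝ} (hn : 0 < n) (hq : 0 < q) (hp : ∀ i, 1 < p i)
    (hαn : α < n) (hsum : ∑ i, 1 / p i = 1 / q + α / n) (i₀ : Fin m) {β : ℝ}
    (hβ : β < (1 - α / n) * ((p i₀).conjExponent / q)) :
    ¬ ∃ C : ℝ≥0, WeightedBound n α q p β C := by
  rintro ⟨C, hC⟩
  have hm : 0 < m := i₀.pos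
  have hn0 : (0 : ℝ) < n := by exact_mod_cast hn
  have hτ1 : α / n < 1 := (div_lt_one hn0).2 hαn
  have hr := (Real.HolderConjugate.conjExponent (hp i₀)).symm.pos
  set b := q / (p i₀).conjExponent with hb
  have hb0 : 0 < b := div_pos hq hr
  obtain ⟨L, hL0, hL⟩ := apqConst_powerWeight_rpow_le (i₀ := i₀) hn hq hp β
  set κ : ℝ := (1 / (n + 1)) ^ m * (4 ^ n) ^ (-((m : ℝ) - α / n)) * (1 / (q * m)) ^ (1 / q) with hκ
  have hκ0 : 0 < κ := by positivity
  set s : ℝ := 1 / q + α / n with hs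
  set B : ℝ := C * L * (n * 2 ^ n) ^ s with hB
  have hγ : b * max β 0 < 1 - α / n := by
    have : max β 0 < (1 - α / n) * ((p i₀).conjExponent / q) :=
      max_lt hβ (mul_pos (by linarith) (by positivity))
    calc b * max β 0 < b * ((1 - α / n) * ((p i₀).conjExponent / q)) :=
          mul_lt_mul_of_pos_left this hb0
      _ = 1 - α / n := by rw [hb]; field_simp
  set η : ℝ := 1 - α / n - b * max β 0 with hη
  have hη0 : 0 < η := by linarith
  have key : ∀ ε : ℝ, 0 < ε → ε < 1 → κ ≤ B * ε ^ η := by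
    intro ε hε hε1
    have hbound := hC _ (memApq_powerWeight (i₀ := i₀) hn hq hp hε hε1) _
      (memSource_testFn hn hp hε hε1)
    have hlow := le_eLpNorm_maximalFn_testFn (i₀ := i₀) hn hq hp hαn hsum hε hε1
    have hD : (0 : ℝ) < n * 2 ^ n / ε := by positivity
    have hprod : ∏ i, eLpNorm (testFn (n := n) p i₀ ε i) (ENNReal.ofReal (p i))
        (sourceMeasure p (powerWeight p i₀ ε) i) ≤ ENNReal.ofReal ((n * 2 ^ n / ε) ^ s) := by
      refine (Finset.prod_le_prod' fun i _ => eLpNorm_testFn_le hn hp hε hε1 i).trans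
        (le_of_eq ?_)
      rw [Finset.prod_congr rfl fun i _ => ENNReal.ofReal_rpow_of_pos hD,
        ← ENNReal.ofReal_prod_of_nonneg fun i _ => by positivity, ← Real.rpow_sum_of_pos hD, hsum]
    have hall := (hlow.trans hbound).trans (mul_le_mul' (mul_le_mul_right (hL ε hε hε1) _) hprod)
    rw [← ENNReal.ofReal_coe_nnreal, ← ENNReal.ofReal_mul (by positivity),
      ← ENNReal.ofReal_mul (by positivity), ENNReal.ofReal_le_ofReal_iff (by positivity),
      ← hκ, ← hb] at hall
    have e1 : C * (L * ε ^ (-(b * max β 0))) * (n * 2 ^ n / ε) ^ s =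
        B * ε ^ η * ε ^ (-(1 + 1 / q)) := by
      rw [Real.div_rpow (by positivity) hε.le, hB, mul_assoc _ (ε ^ η), ← Real.rpow_add hε,
        div_eq_mul_inv, ← Real.rpow_neg hε.le,
        show η + -(1 + 1 / q) = -(b * max β 0) + -s by rw [hη, hs]; ring, Real.rpow_add hε]
      ring
    rw [e1] at hall
    exact le_of_mul_le_mul_right hall (by positivity)
  have hlim : Filter.Tendsto (fun ε : ℝ => B * ε ^ η) (nhdsWithin 0 (Set.Ioi 0)) (nhds 0) := by
    have h := (Real.continuousAt_rpow_const 0 η (Or.inr hη0.le)).tendsto.const_mul B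
    rw [Real.zero_rpow hη0.ne', mul_zero] at h
    exact h.mono_left nhdsWithin_le_nhds
  have hge : κ ≤ 0 := by
    refine ge_of_tendsto hlim ?_
    filter_upwards [Ioo_mem_nhdsGT (zero_lt_one' ℝ)] with ε hε
    exact key ε hε.1 hε.2
  linarith

end Sharpness
end MultiFrac

theorem theorem1p1 {m n : ℕ} (α q : ℝ) (p : Fin m → ℝ)
    (hα : 0 < α) (hαn : α < n) (hq : 0 < q) (hp : ∀ i, 1 < p i)
    (hsum : ∑ i, 1 / p i = 1 / q + α / n)
    (i₀ : Fin m)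
    (hmax : ∀ i, (p i).conjExponent ≤ (p i₀).conjExponent)
    (hgap : ∀ i, i ≠ i₀ → (p i).conjExponent ≤ (p i₀).conjExponent * (1 - α / n)) :
    (∀ w : Fin m → (Fin n → ℝ) → ℝ, MultiFrac.MemApq p q w →
      ∀ f : Fin m → (Fin n → ℝ) → ℂ, MultiFrac.MemSource p w f →
        MemLp (MultiFrac.maximalFn α f) (ENNReal.ofReal q) (MultiFrac.targetMeasure q w)) ∧
    (∃ C : ℝ≥0,
      MultiFrac.WeightedBound n α q p ((1 - α / n) * ((p i₀).conjExponent / q)) C) ∧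
    (∀ β : ℝ, β < (1 - α / n) * ((p i₀).conjExponent / q) →
      ¬ ∃ C : ℝ≥0, MultiFrac.WeightedBound n α q p β C) := by
  have hn' : (0 : ℝ) < n := by linarith
  have hn : 0 < n := by exact_mod_cast hn'
  have hr := (Real.HolderConjugate.conjExponent (hp i₀)).symm.pos
  have hbound := MultiFrac.exists_weightedBound α q p hα hαn hq hp hsum i₀ hgap
  refine ⟨fun w hw f hf => ?_, hbound, fun β hβ =>
    MultiFrac.not_exists_weightedBound hn hq hp hαn hsum i₀ hβ⟩
  obtain ⟨C, hC⟩ := hbound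
  refine ⟨(MultiFrac.measurable_maximalFn i₀.pos hn f).aestronglyMeasurable,
    (hC w hw f hf).trans_lt ?_⟩
  have hτ : 0 ≤ 1 - α / n := by linarith [(div_lt_one hn').2 hαn]
  exact ENNReal.mul_lt_top (ENNReal.mul_lt_top ENNReal.coe_lt_top
    (ENNReal.rpow_lt_top_of_nonneg (mul_nonneg hτ (by positivity)) hw.const_lt_top.ne))
    (ENNReal.prod_lt_top fun i _ => (hf i).2)
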